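/- **Setting.** Let $\mathbb S^{d-1}$ and $\mathbb B^d$ be the unit sphere and the closed unit ball of $\mathbb R^d$, and let $f:[-1,1]\to[-1,1]$ be a known link function. There is an unknown parameter $\theta^\star\in\mathbb S^{d-1}$. In each round $t=1,2,\dots$ a learner chooses, possibly at random, an action $a_t\in\mathbb B^d$ based on the history $\mathcal H_{t-1}=((a_s,r_s))_{s\le t-1}$, and observes $r_t=f(\langle\theta^\star,a_t\rangle)+z_t$, where the $z_t$ are independent standard normal noises. For $\varepsilon\in(0,1/2)$ the sample complexity is $$T^\star(f,d,\varepsilon)=\min\Big\{T:\ \inf\ \sup_{\theta^\star\in\mathbb S^{d-1}}\mathbb E_{\theta^\star}\big[1-\langle\widehat\theta_T,\theta^\star\rangle\big]\le\varepsilon\Big\}$$ (with $\min\emptyset=\infty$), where the infimum is over all learners and all (possibly randomized) estimators $\widehat\theta_T\in\mathbb S^{d-1}$ based on $\mathcal H_T$. The minimax regret is $$\mathfrak R_T^\star(f,d)=\inf\ \sup_{\theta^\star\in\mathbb S^{d-1}}\mathbb E_{\theta^\star}\Big[T\max_{a\in\mathbb B^d}f(\langle\theta^\star,a\rangle)-\sum_{t=1}^Tf(\langle\theta^\star,a_t\rangle)\Big],$$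 where the infimum is over all learners. **Assumptions on $f$.** 1. $f(0)=0$, $f(1)=1$, $|f|\le1$, and either $f$ is non-decreasing on $[-1,1]$, or $f$ is even and non-decreasing on $[0,1]$. 2. $f$ is differentiable on $[0.1,1]$ with $c_f\le f'(x)\le C_f$ for all $x\in[0.1,1]$, where $c_f>0$. 3. $|f(x)-f(y)|\le L|x-y|$ for all $x,y\in[-1,1]$, where $L>0$. Put $g(x)=\max\{|f(x)|,|f(-x)|\}$. **Statement.** There is an absolute constant $c>0$, and for all $c_f,L>0$ there is a constant $C>0$ depending only on $(c_f,L)$, such that for every $d\ge2$ and every $f$ satisfying Assumptions 1, 2 and 3 (with any $C_f$) the following hold. * For every $\varepsilon\in(0,1/2)$, $$T^\star(f,d,\varepsilon)\ \ge\ C\left(\max_{T\ge1}\min\left\{d\int_{\sqrt{c\log(T)/d}}^{1/2}\frac{\mathrm d(x^2)}{g(x)^2},\,T\right\}+\frac{d^2}{\varepsilon}\right).$$ * For every integer $T\ge1$, $$\mathfrak R_T^\star(f,d)\ \ge\ C\min\left\{d\int_{\sqrt{c\log(T)/d}}^{1/2}\frac{\mathrm d(x^2)}{g(x)^2}+d\sqrt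 T,\,T\right\}.$$ Here $\mathrm d(x^2)=2x\,\mathrm dx$, the integral takes values in $[0,\infty]$ (the integrand being $+\infty$ where $g=0$), and it is $0$ if its lower limit is at least $1/2$; the maximum is over integers $T\ge 1$. -/

import Mathlib

open MeasureTheory ProbabilityTheory
open scoped ENNReal

noncomputable section

namespace RidgeBandit

/-- The unit sphere of `ℝ^d`: the parameter set. -/
abbrev Sphere (d : ℕ) : Type :=
  Metric.sphere (0 : EuclideanSpace ℝ (Fin d)) 1

/-- The closed unit ball of `ℝ^d`: the action set. -/
abbrev Ball (d : ℕ) : Type :=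
  Metric.closedBall (0 : EuclideanSpace ℝ (Fin d)) 1

/-- A history of length `t`: the list of (action, reward) pairs of rounds `0, …, t - 1`. -/
abbrev History (d t : ℕ) : Type := Fin t → Ball d × ℝ

/-- A (possibly randomized) adaptive learner: the action after `t` observed rounds is drawn from a
probability law that depends measurably on the history of those `t` rounds. -/
structure Policy (d : ℕ) where
  action : (t : ℕ) → Kernel (History d t) (Ball d)
  isMarkov : ∀ t, IsMarkovKernel (action t)

/-- A (possibly randomized) unit-norm estimator based on a history of length `T`. -/
structure Estimator (d T : ℕ) where
  estimate : Kernel (History d T) (Sphere d)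
  isMarkov : IsMarkovKernel estimate

/-- The mean reward `f(⟨θ, a⟩)`. Only the values of `f` on `[-1, 1]` are ever used. -/
def meanReward {d : ℕ} (f : ℝ → ℝ) (θ : Sphere d) (a : Ball d) : ℝ :=
  f (inner ℝ (θ : EuclideanSpace ℝ (Fin d)) (a : EuclideanSpace ℝ (Fin d)))

/-- The mean reward is a measurable function of the action when `f` is continuous on `[-1, 1]`. -/
theorem measurable_meanReward {d : ℕ} {f : ℝ → ℝ} (hf : ContinuousOn f (Set.Icc (-1) 1))
    (θ : Sphere d) : Measurable (meanReward f θ) := by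
  have : Continuous (meanReward f θ) := by
    unfold meanReward
    refine hf.comp_continuous (by fun_prop) fun a => ?_
    have h := abs_real_inner_le_norm (θ : EuclideanSpace ℝ (Fin d)) (a : EuclideanSpace ℝ (Fin d))
    have h1 : ‖(θ : EuclideanSpace ℝ (Fin d))‖ = 1 := mem_sphere_zero_iff_norm.mp θ.2
    have h2 : ‖(a : EuclideanSpace ℝ (Fin d))‖ ≤ 1 := mem_closedBall_zero_iff.mp a.2
    rw [h1, one_mul] at h
    exact abs_le.mp (h.trans h2)
  exact this.measurable

/-- The law of the history of the first `t` rounds under the parameter `θ`. In each round the action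
`a` is drawn given the past history `h`, then an independent standard normal `z` is drawn, and the
pair `(a, f(⟨θ, a⟩) + z)` is appended to the history. -/
def historyLaw {d : ℕ} (f : ℝ → ℝ) (π : Policy d) (θ : Sphere d) :
    (t : ℕ) → Measure (History d t)
  | 0 => Measure.dirac Fin.elim0
  | t + 1 =>
      ((historyLaw f π θ t ⊗ₘ π.action t).prod (gaussianReal 0 1)).map
        (fun p => (Fin.snoc p.1.1 (p.1.2, meanReward f θ p.1.2 + p.2) : History d (t + 1)))

/-- The history laws are genuine probability measures when `f` is continuous on `[-1, 1]`. -/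
theorem isProbabilityMeasure_historyLaw {d : ℕ} {f : ℝ → ℝ}
    (hf : ContinuousOn f (Set.Icc (-1) 1)) (π : Policy d) (θ : Sphere d) (t : ℕ) :
    IsProbabilityMeasure (historyLaw f π θ t) := by
  induction t with
  | zero => unfold historyLaw; infer_instance
  | succ t ih =>
    have := π.isMarkov t
    unfold historyLaw
    refine Measure.isProbabilityMeasure_map (Measurable.aemeasurable ?_)
    have hm := measurable_meanReward hf θ
    rw [measurable_pi_iff]
    intro i
    refine Fin.lastCases ?_ (fun j => ?_) i
    · simp only [Fin.snoc_last]; fun_prop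
    · simp only [Fin.snoc_castSucc]; fun_prop

/-- The estimation risk `E_θ[1 - ⟨θ̂_T, θ⟩]`. -/
def risk {d T : ℕ} (f : ℝ → ℝ) (π : Policy d) (e : Estimator d T) (θ : Sphere d) : ℝ :=
  ∫ h, ∫ v, (1 - inner ℝ (v : EuclideanSpace ℝ (Fin d)) (θ : EuclideanSpace ℝ (Fin d)))
    ∂(e.estimate h) ∂(historyLaw f π θ T)

/-- The minimax estimation risk with `T` samples: infimum over learners and estimators of the
supremum over the parameter. -/
def minimaxRisk (f : ℝ → ℝ) (d T : ℕ) : ℝ :=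
  ⨅ p : Policy d × Estimator d T, ⨆ θ : Sphere d, risk f p.1 p.2 θ

/-- The sample complexity `T⋆(f, d, ε)`: the least `T` whose minimax risk is at most `ε`, and `⊤`
if there is none. -/
def sampleComplexity (f : ℝ → ℝ) (d : ℕ) (ε : ℝ) : ℕ∞ :=
  ⨅ (T : ℕ) (_ : minimaxRisk f d T ≤ ε), (T : ℕ∞)

/-- The expected cumulative regret
`E_θ[T · max_a f(⟨θ, a⟩) - ∑_t f(⟨θ, a_t⟩)]` of a learner over the horizon `T`. -/
def regret {d : ℕ} (f : ℝ → ℝ) (π : Policy d) (θ : Sphere d) (T : ℕ) : ℝ :=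
  ∫ h, ((T : ℝ) * (⨆ a : Ball d, meanReward f θ a) - ∑ t : Fin T, meanReward f θ (h t).1)
    ∂(historyLaw f π θ T)

/-- The minimax regret over the horizon `T`. -/
def minimaxRegret (f : ℝ → ℝ) (d T : ℕ) : ℝ :=
  ⨅ π : Policy d, ⨆ θ : Sphere d, regret f π θ T

/-- Regularity for the burn-in period: normalized scale, and monotonicity (either increasing on
`[-1, 1]`, or even and increasing on `[0, 1]`; increasing in the weak sense). -/
structure BurnInRegular (f : ℝ → ℝ) : Prop where
  map_zero : f 0 = 0
  map_one : f 1 = 1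
  abs_le_one : ∀ x ∈ Set.Icc (-1 : ℝ) 1, |f x| ≤ 1
  monotone : MonotoneOn f (Set.Icc (-1) 1) ∨
    ((∀ x ∈ Set.Icc (-1 : ℝ) 1, f (-x) = f x) ∧ MonotoneOn f (Set.Icc 0 1))

/-- Regularity for the learning phase: `f` is differentiable on `[0.1, 1]` (one-sided at the end
points) and its derivative there lies between `cf` and `Cf`. -/
structure LearningRegular (f : ℝ → ℝ) (cf Cf : ℝ) : Prop where
  differentiableOn : DifferentiableOn ℝ f (Set.Icc (1 / 10) 1)
  le_deriv : ∀ x ∈ Set.Icc (1 / 10 : ℝ) 1, cf ≤ derivWithin f (Set.Icc (1 / 10) 1) x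
  deriv_le : ∀ x ∈ Set.Icc (1 / 10 : ℝ) 1, derivWithin f (Set.Icc (1 / 10) 1) x ≤ Cf

/-- `f` is `L`-Lipschitz on `[-1, 1]`. -/
def LipschitzRegular (f : ℝ → ℝ) (L : ℝ) : Prop :=
  ∀ x ∈ Set.Icc (-1 : ℝ) 1, ∀ y ∈ Set.Icc (-1 : ℝ) 1, |f x - f y| ≤ L * |x - y|

/-- `g(x) = max {|f(x)|, |f(-x)|}`. -/
def envelope (f : ℝ → ℝ) (x : ℝ) : ℝ := max |f x| |f (-x)|

/-- The integral `∫_a^{1/2} d(x²) / g(x)²` with `d(x²) = 2x dx`, valued in `[0, ∞]`: the integrand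
is `∞` where `g` vanishes, and the integral is `0` if `a ≥ 1/2`. -/
def burnInIntegral (f : ℝ → ℝ) (a : ℝ) : ℝ≥0∞ :=
  ∫⁻ x in Set.Ioc a (1 / 2), ENNReal.ofReal (2 * x) / ENNReal.ofReal (envelope f x ^ 2)

end RidgeBandit

end

namespace RidgeBandit

/-! ### The law of the history for a general mean reward function -/

/-! Two separate lower bounds are proved, each by averaging over the vertices of a cube of
parameters. In both, the laws of the history are compared with the reference law under which every
mean reward is `0`. The policy's kernels are common to all these laws, so the density is a product
of Gaussian factors, `likelihood`.

Burn-in. Let θ be uniform on the vertices with coordinates ±1/√d. Under the reference law, any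
action or estimate y computed from the history is independent of θ, so |⟨θ, y⟩| > x has probability
at most 2 exp(-d x²/2). As long as the correlations up to round t stay below √u_s, the mean rewards
are at most g(√u_s), and the truncated second moment of the likelihood ratio is at most exp(∑
g(√u_s)²) (`lintegral_likelihood_sq_le`). By Cauchy–Schwarz the true probability of crossing √u_t at
the next step is then of order exp(∑ g(√u_s)²/2 - d u_t/4). The recursion u_{t+1} = u_t + (2/d)
g(√u_t)² (`barrier`) makes this exp(-d u_0/4) up to a constant. With u_0 = 20 log T / d a union
bound over T rounds succeeds: the learner stays below the barrier (`sum_goodSet_compl_le`). The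
recursion is an Euler scheme for du/g² = (2/d) dt, so by monotonicity of g the barrier remains below
1/16 while t is less than (d/2) times the integral up to 1/4 (`barrier_le`). Until then every action
has constant regret and every estimator has risk at least 1/2.

Learning. Let θ be a vertex of a cube of half-side δ around the north pole. Estimating the i-th sign
means distinguishing θ from its flip. The squared Hellinger distance between the two history laws is
at most of order L²δ² times the expected squared length spent on coordinate i
(`lintegral_hellinger_le`, `sum_integral_inner_le`). For estimation, total exploration is at most t,
which gives d²/ε. For regret, exploration is itself paid for by regret, since an action close to θ
is almost parallel to the pole; balancing the two gives d√T.

The burn-in integral over (1/4, 1/2] is at most 9/c_f², and d times this is absorbed by the learning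
bound, whence the stated combination. -/

/-- The history `h` extended by the action `a` and the reward `r`. -/
def History.extend {d t : ℕ} (h : History d t) (a : Ball d) (r : ℝ) : History d (t + 1) :=
  Fin.snoc h (a, r)

@[simp] theorem History.extend_castSucc {d t : ℕ} (h : History d t) (a : Ball d) (r : ℝ)
    (s : Fin t) : h.extend a r s.castSucc = h s := by
  simp [History.extend]

@[simp] theorem History.extend_last {d t : ℕ} (h : History d t) (a : Ball d) (r : ℝ) :
    h.extend a r (Fin.last t) = (a, r) := by
  simp [History.extend]

theorem measurable_extend {d t : ℕ} {α : Type*} [MeasurableSpace α] {h : α → History d t}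
    {a : α → Ball d} {r : α → ℝ} (hh : Measurable h) (ha : Measurable a) (hr : Measurable r) :
    Measurable fun x => (h x).extend (a x) (r x) := by
  rw [measurable_pi_iff]
  intro i
  refine Fin.lastCases ?_ (fun j => ?_) i
  · simp only [History.extend_last]; fun_prop
  · simp only [History.extend_castSucc]; fun_prop

/-- The law of the history of the first `t` rounds when the action `a` has mean reward `m a`. -/
noncomputable def banditLaw {d : ℕ} (π : Policy d) (m : Ball d → ℝ) :
    (t : ℕ) → Measure (History d t)
  | 0 => Measure.dirac Fin.elim0
  | t + 1 =>
      ((banditLaw π m t ⊗ₘ π.action t).prod (gaussianReal 0 1)).map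
        (fun p => p.1.1.extend p.1.2 (m p.1.2 + p.2))

theorem historyLaw_eq_banditLaw {d : ℕ} (f : ℝ → ℝ) (π : Policy d) (θ : Sphere d) (t : ℕ) :
    historyLaw f π θ t = banditLaw π (meanReward f θ) t := by
  induction t with
  | zero => rfl
  | succ t ih => rw [historyLaw, banditLaw, ih]; rfl

theorem isProbabilityMeasure_banditLaw {d : ℕ} (π : Policy d) {m : Ball d → ℝ} (hm : Measurable m)
    (t : ℕ) : IsProbabilityMeasure (banditLaw π m t) := by
  induction t with
  | zero => unfold banditLaw; infer_instance
  | succ t ih =>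
    have := π.isMarkov t
    unfold banditLaw
    exact Measure.isProbabilityMeasure_map
      (measurable_extend (by fun_prop) (by fun_prop) (by fun_prop)).aemeasurable

theorem lintegral_banditLaw_succ {d : ℕ} (π : Policy d) {m : Ball d → ℝ} (hm : Measurable m)
    {t : ℕ} {G : History d (t + 1) → ℝ≥0∞} (hG : Measurable G) :
    ∫⁻ h, G h ∂(banditLaw π m (t + 1)) =
      ∫⁻ h, ∫⁻ a, ∫⁻ z, G (h.extend a (m a + z)) ∂(gaussianReal 0 1) ∂(π.action t h)
        ∂(banditLaw π m t) := by
  have := π.isMarkov t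
  have := isProbabilityMeasure_banditLaw π hm t
  have hext : Measurable fun p : (History d t × Ball d) × ℝ =>
      p.1.1.extend p.1.2 (m p.1.2 + p.2) :=
    measurable_extend (by fun_prop) (by fun_prop) (by fun_prop)
  have hGe : Measurable fun p : (History d t × Ball d) × ℝ =>
      G (p.1.1.extend p.1.2 (m p.1.2 + p.2)) := hG.comp hext
  rw [banditLaw, lintegral_map hG hext, lintegral_prod _ hGe.aemeasurable,
    Measure.lintegral_compProd hGe.lintegral_prod_right']

/-- The ratio of the densities of N(μ, 1) and N(0, 1) at z is exp(μ z - μ²/2). This is the one-round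
change of measure. -/
theorem lintegral_gaussianReal_add (μ : ℝ) {G : ℝ → ℝ≥0∞} (hG : Measurable G) :
    ∫⁻ z, G (μ + z) ∂(gaussianReal 0 1) =
      ∫⁻ z, G z * ENNReal.ofReal (Real.exp (μ * z - μ ^ 2 / 2)) ∂(gaussianReal 0 1) := by
  have h1 := lintegral_map (μ := gaussianReal 0 1) hG (measurable_const_add μ)
  rw [gaussianReal_map_const_add, zero_add] at h1
  rw [← h1, gaussianReal_of_var_ne_zero _ one_ne_zero, gaussianReal_of_var_ne_zero _ one_ne_zero,
    lintegral_withDensity_eq_lintegral_mul _ (measurable_gaussianPDF _ _) hG,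
    lintegral_withDensity_eq_lintegral_mul _ (measurable_gaussianPDF _ _) (by fun_prop)]
  refine lintegral_congr fun z => ?_
  simp only [Pi.mul_apply, gaussianPDF]
  rw [mul_comm (G z), ← mul_assoc, ← ENNReal.ofReal_mul (gaussianPDFReal_nonneg _ _ _)]
  congr 2
  simp only [gaussianPDFReal, NNReal.coe_one, mul_one]
  rw [mul_assoc, ← Real.exp_add]
  congr 2
  ring

theorem lintegral_gaussianReal_exp (s b : ℝ) :
    ∫⁻ z, ENNReal.ofReal (Real.exp (s * z + b)) ∂(gaussianReal 0 1) =
      ENNReal.ofReal (Real.exp (s ^ 2 / 2 + b)) := by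
  have h := lintegral_gaussianReal_add s (G := fun _ => 1) measurable_const
  simp only [lintegral_const, measure_univ, mul_one, one_mul] at h
  have h2 : ∀ z : ℝ, ENNReal.ofReal (Real.exp (s * z + b)) =
      ENNReal.ofReal (Real.exp (s ^ 2 / 2 + b)) *
        ENNReal.ofReal (Real.exp (s * z - s ^ 2 / 2)) := by
    intro z
    rw [← ENNReal.ofReal_mul (Real.exp_pos _).le, ← Real.exp_add]
    congr 2; ring
  simp_rw [h2]
  rw [lintegral_const_mul _ (by fun_prop), ← h, mul_one]

/-! ### Likelihood ratios -/

/-- The likelihood ratio of the mean reward function `m` against the mean reward function `0`. -/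
noncomputable def likelihood {d t : ℕ} (m : Ball d → ℝ) (h : History d t) : ℝ :=
  ∏ s, Real.exp (m (h s).1 * (h s).2 - m (h s).1 ^ 2 / 2)

theorem likelihood_pos {d t : ℕ} (m : Ball d → ℝ) (h : History d t) : 0 < likelihood m h :=
  Finset.prod_pos fun _ _ => Real.exp_pos _

theorem likelihood_extend {d t : ℕ} (m : Ball d → ℝ) (h : History d t) (a : Ball d) (r : ℝ) :
    likelihood m (h.extend a r) = likelihood m h * Real.exp (m a * r - m a ^ 2 / 2) := by
  simp [likelihood, Fin.prod_univ_castSucc]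

@[fun_prop]
theorem measurable_likelihood {d t : ℕ} {m : Ball d → ℝ} (hm : Measurable m) :
    Measurable (likelihood m : History d t → ℝ) := by
  unfold likelihood
  fun_prop

/-- Actions are drawn from the same kernel under both laws given the same history, so only the
reward densities contribute. The induction shifts the Gaussian of the last round. -/
theorem lintegral_banditLaw {d : ℕ} (π : Policy d) {m : Ball d → ℝ} (hm : Measurable m)
    {t : ℕ} {G : History d t → ℝ≥0∞} (hG : Measurable G) :
    ∫⁻ h, G h ∂(banditLaw π m t) =
      ∫⁻ h, G h * ENNReal.ofReal (likelihood m h) ∂(banditLaw π 0 t) := by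
  induction t with
  | zero => simp [banditLaw, likelihood]
  | succ t ih =>
    have := π.isMarkov t
    have hG' : Measurable fun p : (History d t × Ball d) × ℝ =>
      G (p.1.1.extend p.1.2 (m p.1.2 + p.2)) :=
      hG.comp (measurable_extend (by fun_prop) (by fun_prop) (by fun_prop))
    have hG'' : Measurable fun h : History d t =>
        ∫⁻ a, ∫⁻ z, G (h.extend a (m a + z)) ∂(gaussianReal 0 1) ∂(π.action t h) :=
      Measurable.lintegral_kernel_prod_right (κ := π.action t) (hG'.lintegral_prod_right')
    have hE : Measurable fun p : (History d t × Ball d) × ℝ => G (p.1.1.extend p.1.2 p.2) *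
        ENNReal.ofReal (Real.exp (m p.1.2 * p.2 - m p.1.2 ^ 2 / 2)) :=
      (hG.comp (measurable_extend (by fun_prop) (by fun_prop) (by fun_prop))).mul (by fun_prop)
    have hGL : Measurable fun h : History d (t + 1) => G h * ENNReal.ofReal (likelihood m h) :=
      hG.mul (measurable_likelihood hm).ennreal_ofReal
    rw [lintegral_banditLaw_succ π hm hG, ih hG'', lintegral_banditLaw_succ π measurable_zero hGL]
    refine lintegral_congr fun h => ?_
    have h1 : ∀ a : Ball d, ∫⁻ z, G (h.extend a (m a + z)) ∂(gaussianReal 0 1) =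
        ∫⁻ z, G (h.extend a z) * ENNReal.ofReal (Real.exp (m a * z - m a ^ 2 / 2))
          ∂(gaussianReal 0 1) := fun a =>
      lintegral_gaussianReal_add (m a) (G := fun z => G (h.extend a z))
        (hG.comp (measurable_extend measurable_const measurable_const measurable_id))
    simp_rw [h1]
    rw [← lintegral_mul_const]
    · refine lintegral_congr fun a => ?_
      have hEz : Measurable fun z : ℝ => G (h.extend a z) *
          ENNReal.ofReal (Real.exp (m a * z - m a ^ 2 / 2)) :=
        hE.comp (f := fun z : ℝ => ((h, a), z)) (by fun_prop)
      rw [← lintegral_mul_const _ hEz]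
      refine lintegral_congr fun z => ?_
      rw [Pi.zero_apply, zero_add, likelihood_extend, ENNReal.ofReal_mul (likelihood_pos _ _).le]
      ring
    · exact (hE.lintegral_prod_right' (ν := gaussianReal 0 1)).comp
        (f := fun a : Ball d => (h, a)) (by fun_prop)

/-- The law of the first `t` rounds is the marginal of the law of the first `t + 1` rounds. -/
theorem lintegral_banditLaw_init {d : ℕ} (π : Policy d) {m : Ball d → ℝ} (hm : Measurable m)
    {t : ℕ} {G : History d t → ℝ≥0∞} (hG : Measurable G) :
    ∫⁻ h, G (Fin.init h) ∂(banditLaw π m (t + 1)) = ∫⁻ h, G h ∂(banditLaw π m t) := by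
  have := π.isMarkov t
  have hinit : Measurable fun h : History d (t + 1) => (Fin.init h : History d t) := by
    unfold Fin.init; fun_prop
  have hGi : Measurable fun h : History d (t + 1) => G (Fin.init h) := hG.comp hinit
  rw [lintegral_banditLaw_succ π hm hGi]
  refine lintegral_congr fun h => ?_
  simp [History.extend]

theorem map_init_banditLaw {d : ℕ} (π : Policy d) {m : Ball d → ℝ} (hm : Measurable m) (t : ℕ) :
    (banditLaw π m (t + 1)).map (fun h => (Fin.init h : History d t)) = banditLaw π m t := by
  have hinit : Measurable fun h : History d (t + 1) => (Fin.init h : History d t) := by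
    unfold Fin.init; fun_prop
  refine Measure.ext_of_lintegral _ fun G hG => ?_
  rw [lintegral_map hG hinit, lintegral_banditLaw_init π hm hG]

theorem lintegral_reference_succ {d : ℕ} (π : Policy d) {t : ℕ} {G : History d (t + 1) → ℝ≥0∞}
    (hG : Measurable G) :
    ∫⁻ h, G h ∂(banditLaw π 0 (t + 1)) =
      ∫⁻ h, ∫⁻ a, ∫⁻ z, G (h.extend a z) ∂(gaussianReal 0 1) ∂(π.action t h)
        ∂(banditLaw π 0 t) := by
  simpa using lintegral_banditLaw_succ π measurable_zero hG

/-- Second moment of the likelihood ratio on the event that the mean rewards are small. -/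
theorem lintegral_likelihood_sq_le {d : ℕ} (π : Policy d) {m : Ball d → ℝ} (hm : Measurable m)
    (b : ℕ → ℝ) (t : ℕ) :
    ∫⁻ h in {h | ∀ s : Fin t, |m (h s).1| ≤ b s}, ENNReal.ofReal (likelihood m h ^ 2)
        ∂(banditLaw π 0 t) ≤ ENNReal.ofReal (Real.exp (∑ s ∈ Finset.range t, b s ^ 2)) := by
  have hS : ∀ t, MeasurableSet {h : History d t | ∀ s : Fin t, |m (h s).1| ≤ b s} := fun t => by
    rw [Set.ofPred_forall]
    exact MeasurableSet.iInter fun s => measurableSet_le (by fun_prop) (by fun_prop)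
  induction t with
  | zero =>
    rw [banditLaw]
    refine (setLIntegral_le_lintegral _ _).trans ?_
    simp [likelihood]
  | succ t ih =>
    have := π.isMarkov t
    rw [← lintegral_indicator (hS _)] at ih ⊢
    rw [lintegral_reference_succ π (Measurable.indicator (by fun_prop) (hS _))]
    have key : ∀ (h : History d t) (a : Ball d), ∫⁻ z,
        Set.indicator {h : History d (t + 1) | ∀ s : Fin (t + 1), |m (h s).1| ≤ b s}
          (fun h => ENNReal.ofReal (likelihood m h ^ 2)) (h.extend a z) ∂(gaussianReal 0 1) ≤
        Set.indicator {h : History d t | ∀ s : Fin t, |m (h s).1| ≤ b s}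
          (fun h => ENNReal.ofReal (likelihood m h ^ 2)) h *
          ENNReal.ofReal (Real.exp (b t ^ 2)) := by
      intro h a
      by_cases hh : (∀ s : Fin t, |m (h s).1| ≤ b s) ∧ |m a| ≤ b t
      · have h1 : ∀ z, h.extend a z ∈
            {h : History d (t + 1) | ∀ s : Fin (t + 1), |m (h s).1| ≤ b s} := by
          intro z
          rw [Set.mem_ofPred_eq, Fin.forall_fin_succ']
          simpa using hh
        rw [Set.indicator_of_mem (show h ∈ {h : History d t | ∀ s : Fin t, |m (h s).1| ≤ b s} from hh.1)]
        simp_rw [Set.indicator_of_mem (h1 _)]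
        -- The squared factor of the last round is exp(2 m z - m²), whose Gaussian mean is exp(m²) ≤
        -- exp(b_t²).
        have h2 : ∀ z, ENNReal.ofReal (likelihood m (h.extend a z) ^ 2) =
            ENNReal.ofReal (likelihood m h ^ 2) *
              ENNReal.ofReal (Real.exp (2 * m a * z + -(m a ^ 2))) := by
          intro z
          rw [← ENNReal.ofReal_mul (by positivity), likelihood_extend, mul_pow, ← Real.exp_nat_mul]
          congr 3
          push_cast; ring
        simp_rw [h2]
        rw [lintegral_const_mul _ (by fun_prop), lintegral_gaussianReal_exp]
        gcongr
        have := sq_le_sq' (neg_le_of_abs_le hh.2) (le_of_abs_le hh.2)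
        linarith
      · have h1 : ∀ z, h.extend a z ∉
            {h : History d (t + 1) | ∀ s : Fin (t + 1), |m (h s).1| ≤ b s} := by
          intro z
          rw [Set.mem_ofPred_eq, Fin.forall_fin_succ']
          simpa using hh
        simp_rw [Set.indicator_of_notMem (h1 _)]
        simp
    calc _ ≤ ∫⁻ h, ∫⁻ _a, Set.indicator {h : History d t | ∀ s : Fin t, |m (h s).1| ≤ b s}
          (fun h => ENNReal.ofReal (likelihood m h ^ 2)) h *
          ENNReal.ofReal (Real.exp (b t ^ 2)) ∂(π.action t h) ∂(banditLaw π 0 t) :=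
          lintegral_mono fun h => lintegral_mono fun a => key h a
      _ = (∫⁻ h, Set.indicator {h : History d t | ∀ s : Fin t, |m (h s).1| ≤ b s}
          (fun h => ENNReal.ofReal (likelihood m h ^ 2)) h ∂(banditLaw π 0 t)) *
          ENNReal.ofReal (Real.exp (b t ^ 2)) := by
          simp only [lintegral_const, measure_univ, mul_one]
          rw [lintegral_mul_const _ (Measurable.indicator (by fun_prop) (hS _))]
      _ ≤ _ := by
          rw [Finset.sum_range_succ, Real.exp_add, ENNReal.ofReal_mul (Real.exp_pos _).le]
          gcongr

/-! ### Hellinger distance -/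

/-- Expanding the square, the cross term integrates to 2√(pq) exp(-(μ - ν)²/8). Then 1 - exp(-x) ≤ x
and 2√(pq) ≤ p + q give the increment caused by one round. -/
theorem lintegral_gaussianReal_hellinger_le {p q : ℝ} (hp : 0 ≤ p) (hq : 0 ≤ q) (μ ν : ℝ) :
    ∫⁻ z, ENNReal.ofReal ((√(p * Real.exp (μ * z - μ ^ 2 / 2)) -
        √(q * Real.exp (ν * z - ν ^ 2 / 2))) ^ 2) ∂(gaussianReal 0 1) ≤
      ENNReal.ofReal ((√p - √q) ^ 2) + ENNReal.ofReal (1 / 8 * (p + q) * (μ - ν) ^ 2) := by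
  have hI : ∀ s b : ℝ, Integrable (fun z => Real.exp (s * z + b)) (gaussianReal 0 1) := by
    intro s b
    simp_rw [Real.exp_add]
    exact (integrable_exp_mul_gaussianReal s).mul_const _
  have hV : ∀ s b : ℝ, ∫ z, Real.exp (s * z + b) ∂(gaussianReal 0 1) =
      Real.exp (s ^ 2 / 2 + b) := by
    intro s b
    simp_rw [Real.exp_add]
    rw [integral_mul_const]
    congr 1
    have := congrFun (mgf_id_gaussianReal (μ := 0) (v := 1)) s
    simpa [mgf] using this
  have hexp : ∀ z, (√(p * Real.exp (μ * z - μ ^ 2 / 2)) -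
        √(q * Real.exp (ν * z - ν ^ 2 / 2))) ^ 2 =
      p * Real.exp (μ * z + -(μ ^ 2 / 2)) + q * Real.exp (ν * z + -(ν ^ 2 / 2)) -
        2 * (√p * √q) * Real.exp ((μ + ν) / 2 * z + -((μ ^ 2 + ν ^ 2) / 4)) := by
    intro z
    rw [sub_sq, Real.sq_sqrt (by positivity), Real.sq_sqrt (by positivity), Real.sqrt_mul hp,
      Real.sqrt_mul hq, ← Real.exp_half, ← Real.exp_half,
      show (μ + ν) / 2 * z + -((μ ^ 2 + ν ^ 2) / 4) =
        (μ * z - μ ^ 2 / 2) / 2 + (ν * z - ν ^ 2 / 2) / 2 by ring,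
      Real.exp_add ((μ * z - μ ^ 2 / 2) / 2), ← sub_eq_add_neg, ← sub_eq_add_neg]
    ring
  simp_rw [hexp]
  rw [← ofReal_integral_eq_lintegral_ofReal, integral_sub, integral_add, integral_const_mul,
    integral_const_mul, integral_const_mul, hV, hV, hV, ← ENNReal.ofReal_add (by positivity)
    (by positivity)]
  · refine ENNReal.ofReal_le_ofReal ?_
    rw [show μ ^ 2 / 2 + -(μ ^ 2 / 2) = 0 by ring, show ν ^ 2 / 2 + -(ν ^ 2 / 2) = 0 by ring,
      show ((μ + ν) / 2) ^ 2 / 2 + -((μ ^ 2 + ν ^ 2) / 4) = -(μ - ν) ^ 2 / 8 by ring,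
      Real.exp_zero, sub_sq √p, Real.sq_sqrt hp, Real.sq_sqrt hq]
    have h1 := Real.add_one_le_exp (-(μ - ν) ^ 2 / 8)
    have h2 : 2 * (√p * √q) ≤ p + q := by
      have := sq_nonneg (√p - √q)
      rw [sub_sq, Real.sq_sqrt hp, Real.sq_sqrt hq] at this
      linarith
    have h3 : 0 ≤ √p * √q := by positivity
    nlinarith [mul_le_mul_of_nonneg_left h1 h3, mul_le_mul_of_nonneg_right h2 (sq_nonneg (μ - ν))]
  · exact (hI _ _).const_mul _
  · exact (hI _ _).const_mul _
  · exact ((hI _ _).const_mul _).add ((hI _ _).const_mul _)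
  · exact (hI _ _).const_mul _
  · exact (((hI _ _).const_mul _).add ((hI _ _).const_mul _)).sub ((hI _ _).const_mul _)
  · refine Filter.Eventually.of_forall fun z => ?_
    simp only [← hexp]
    exact sq_nonneg _

/-- The squared Hellinger distance grows in each round by at most the Gaussian increment at the
chosen action. The likelihoods are martingales under the reference law, so the weights p + q of
earlier rounds can be replaced by those at time t. -/
theorem lintegral_hellinger_le {d : ℕ} (π : Policy d) {m n : Ball d → ℝ} (hm : Measurable m)
    (hn : Measurable n) (t : ℕ) :
    ∫⁻ h, ENNReal.ofReal ((√(likelihood m h) - √(likelihood n h)) ^ 2) ∂(banditLaw π 0 t) ≤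
      ∫⁻ h, ENNReal.ofReal (1 / 8 * (likelihood m h + likelihood n h) *
        ∑ s : Fin t, (m (h s).1 - n (h s).1) ^ 2) ∂(banditLaw π 0 t) := by
  induction t with
  | zero => simp [banditLaw, likelihood]
  | succ t ih =>
    have := π.isMarkov t
    have hc : ∀ p a : ℝ, 0 ≤ p → ∫⁻ z, ENNReal.ofReal (p * Real.exp (a * z - a ^ 2 / 2))
        ∂(gaussianReal 0 1) = ENNReal.ofReal p := by
      intro p a hp
      simp_rw [ENNReal.ofReal_mul hp, sub_eq_add_neg]
      rw [lintegral_const_mul _ (by fun_prop), lintegral_gaussianReal_exp]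
      simp
    have hR : ∀ (h : History d t) (a : Ball d), ∫⁻ z, ENNReal.ofReal (1 / 8 *
        (likelihood m (h.extend a z) + likelihood n (h.extend a z)) *
        ∑ s : Fin (t + 1), (m (h.extend a z s).1 - n (h.extend a z s).1) ^ 2)
          ∂(gaussianReal 0 1) =
        ENNReal.ofReal (1 / 8 * (likelihood m h + likelihood n h) *
          ∑ s : Fin t, (m (h s).1 - n (h s).1) ^ 2) +
        ENNReal.ofReal (1 / 8 * (likelihood m h + likelihood n h) * (m a - n a) ^ 2) := by
      intro h a
      have hp := likelihood_pos m h
      have hq := likelihood_pos n h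
      set S := ∑ s : Fin t, (m (h s).1 - n (h s).1) ^ 2 with hS
      have hS0 : 0 ≤ S := Finset.sum_nonneg fun _ _ => sq_nonneg _
      rw [← ENNReal.ofReal_add (by positivity) (by positivity)]
      simp only [Fin.sum_univ_castSucc, History.extend_castSucc, History.extend_last,
        likelihood_extend, ← hS]
      have e : ∀ z, ENNReal.ofReal (1 / 8 * (likelihood m h * Real.exp (m a * z - m a ^ 2 / 2) +
            likelihood n h * Real.exp (n a * z - n a ^ 2 / 2)) * (S + (m a - n a) ^ 2)) =
          ENNReal.ofReal (1 / 8 * likelihood m h * (S + (m a - n a) ^ 2) *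
            Real.exp (m a * z - m a ^ 2 / 2)) +
          ENNReal.ofReal (1 / 8 * likelihood n h * (S + (m a - n a) ^ 2) *
            Real.exp (n a * z - n a ^ 2 / 2)) := by
        intro z
        rw [← ENNReal.ofReal_add (by positivity) (by positivity)]
        congr 1; ring
      simp_rw [e]
      rw [lintegral_add_left (by fun_prop), hc _ _ (by positivity), hc _ _ (by positivity),
        ← ENNReal.ofReal_add (by positivity) (by positivity)]
      congr 1; ring
    rw [lintegral_reference_succ π (by fun_prop), lintegral_reference_succ π (by fun_prop)]
    simp_rw [hR]
    calc _ ≤ ∫⁻ h, ∫⁻ a, (ENNReal.ofReal ((√(likelihood m h) - √(likelihood n h)) ^ 2) +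
          ENNReal.ofReal (1 / 8 * (likelihood m h + likelihood n h) * (m a - n a) ^ 2))
          ∂(π.action t h) ∂(banditLaw π 0 t) := by
          refine lintegral_mono fun h => lintegral_mono fun a => ?_
          simp_rw [likelihood_extend]
          exact lintegral_gaussianReal_hellinger_le (likelihood_pos _ _).le
            (likelihood_pos _ _).le _ _
      _ ≤ _ := by
          simp_rw [lintegral_add_left measurable_const, lintegral_const, measure_univ, mul_one]
          rw [lintegral_add_left (by fun_prop), lintegral_add_left (by fun_prop)]
          gcongr

/-! ### The hypercube -/

/-- The sign encoded by a Boolean. -/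
def sgn (b : Bool) : ℝ := if b then 1 else -1

theorem sgn_sq (b : Bool) : sgn b ^ 2 = 1 := by cases b <;> simp [sgn]

/-- The signs are independent, so the sum factors into hyperbolic cosines, and cosh x ≤ exp(x²/2).
-/
theorem sum_exp_sgn_le {n : ℕ} (r : ℝ) {y : Fin n → ℝ} (hy : ∑ i, y i ^ 2 ≤ 1) :
    ∑ ξ : Fin n → Bool, Real.exp (r * ∑ i, sgn (ξ i) * y i) ≤ 2 ^ n * Real.exp (r ^ 2 / 2) := by
  have h1 := Finset.prod_univ_sum (fun _ : Fin n => (Finset.univ : Finset Bool))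
    (fun i b => Real.exp (r * (sgn b * y i)))
  rw [Fintype.piFinset_univ] at h1
  simp_rw [Finset.mul_sum, Real.exp_sum]
  rw [← h1]
  calc ∏ i, ∑ b, Real.exp (r * (sgn b * y i))
      ≤ ∏ i, (2 * Real.exp ((r * y i) ^ 2 / 2)) := by
        refine Finset.prod_le_prod (fun i _ => by positivity) fun i _ => ?_
        have := Real.cosh_le_exp_half_sq (r * y i)
        rw [Real.cosh_eq] at this
        simp only [Fintype.sum_bool, sgn, if_true, Bool.false_eq_true, if_false, one_mul,
          neg_one_mul, mul_neg]
        linarith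
    _ = 2 ^ n * Real.exp (∑ i, (r * y i) ^ 2 / 2) := by
        rw [Finset.prod_mul_distrib, Real.exp_sum]; simp
    _ ≤ _ := by
        gcongr
        rw [← Finset.sum_div]
        simp_rw [mul_pow]
        rw [← Finset.mul_sum]
        nlinarith [sq_nonneg r]

/-- Chernoff's bound on both tails, with the optimal exponential parameter equal to the threshold r.
-/
theorem card_sgn_le {n : ℕ} {r : ℝ} (hr : 0 ≤ r) {y : Fin n → ℝ} (hy : ∑ i, y i ^ 2 ≤ 1) :
    ((Finset.univ.filter fun ξ : Fin n → Bool => r < |∑ i, sgn (ξ i) * y i|).card : ℝ) ≤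
      2 ^ n * (2 * Real.exp (-r ^ 2 / 2)) := by
  have h1 := sum_exp_sgn_le r hy
  have h2 := sum_exp_sgn_le (-r) hy
  have h3 : ((Finset.univ.filter fun ξ : Fin n → Bool => r < |∑ i, sgn (ξ i) * y i|).card : ℝ) *
      Real.exp (r ^ 2) ≤ ∑ ξ : Fin n → Bool, (Real.exp (r * ∑ i, sgn (ξ i) * y i) +
        Real.exp (-r * ∑ i, sgn (ξ i) * y i)) := by
    rw [Finset.card_eq_sum_ones, Nat.cast_sum, Finset.sum_mul]
    refine (Finset.sum_le_sum fun ξ hξ => ?_).trans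
      (Finset.sum_le_sum_of_subset_of_nonneg (Finset.subset_univ _) fun _ _ _ => by positivity)
    rw [Finset.mem_filter] at hξ
    have hlt := hξ.2
    rw [Nat.cast_one, one_mul, sq]
    rcases lt_abs.mp hlt with h | h
    · have := Real.exp_le_exp.mpr (mul_le_mul_of_nonneg_left h.le hr)
      have := Real.exp_pos (-r * ∑ i, sgn (ξ i) * y i)
      linarith
    · have := Real.exp_le_exp.mpr (mul_le_mul_of_nonneg_left h.le hr)
      rw [mul_neg, ← neg_mul] at this
      have := Real.exp_pos (r * ∑ i, sgn (ξ i) * y i)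
      linarith
  rw [Finset.sum_add_distrib] at h3
  rw [neg_sq] at h2
  have h4 : 2 ^ n * (2 * Real.exp (-r ^ 2 / 2)) * Real.exp (r ^ 2) =
      2 * (2 ^ n * Real.exp (r ^ 2 / 2)) := by
    have : Real.exp (r ^ 2 / 2) = Real.exp (-r ^ 2 / 2) * Real.exp (r ^ 2) := by
      rw [← Real.exp_add]; congr 1; ring
    rw [this]; ring
  refine le_of_mul_le_mul_right ?_ (Real.exp_pos (r ^ 2))
  linarith

/-- The vertices of the cube inscribed in the sphere. -/
noncomputable def cubeVertex {d : ℕ} (hd : 0 < d) (ξ : Fin d → Bool) : Sphere d :=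
  ⟨WithLp.toLp 2 fun i => sgn (ξ i) / √d, by
    rw [mem_sphere_zero_iff_norm, EuclideanSpace.norm_eq]
    have : (d : ℝ) ≠ 0 := by positivity
    simp [div_pow, sgn_sq, this]⟩

theorem inner_cubeVertex {d : ℕ} (hd : 0 < d) (ξ : Fin d → Bool)
    (y : EuclideanSpace ℝ (Fin d)) :
    inner ℝ (cubeVertex hd ξ : EuclideanSpace ℝ (Fin d)) y =
      (∑ i, sgn (ξ i) * y i) / √d := by
  simp only [cubeVertex, PiLp.inner_apply, Finset.sum_div]
  refine Finset.sum_congr rfl fun i _ => ?_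
  simp only [RCLike.inner_apply, conj_trivial]
  ring

theorem sum_sq_le_one {d : ℕ} {y : EuclideanSpace ℝ (Fin d)} (hy : ‖y‖ ≤ 1) :
    ∑ i, y i ^ 2 ≤ 1 := by
  rw [← EuclideanSpace.real_norm_sq_eq]
  exact pow_le_one₀ (norm_nonneg _) hy

theorem card_cubeVertex_le {d : ℕ} (hd : 0 < d) {x : ℝ} (hx : 0 ≤ x)
    {y : EuclideanSpace ℝ (Fin d)} (hy : ‖y‖ ≤ 1) :
    ((Finset.univ.filter fun ξ : Fin d → Bool =>
      x < |inner ℝ (cubeVertex hd ξ : EuclideanSpace ℝ (Fin d)) y|).card : ℝ) ≤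
      2 ^ d * (2 * Real.exp (-(d * x ^ 2) / 2)) := by
  have hd' : 0 < √(d : ℝ) := by positivity
  have h := card_sgn_le (r := √d * x) (by positivity) (sum_sq_le_one hy)
  rw [mul_pow, Real.sq_sqrt (by positivity)] at h
  have e : ∀ ξ, x < |inner ℝ (cubeVertex hd ξ : EuclideanSpace ℝ (Fin d)) y| ↔
      √d * x < |∑ i, sgn (ξ i) * y i| := fun ξ => by
    rw [inner_cubeVertex, abs_div, abs_of_pos hd', lt_div_iff₀ hd', mul_comm]
  simpa only [e] using h

/-- A point that is chosen independently of a random vertex of the cube is rarely correlated with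
it, even after a change of measure with bounded second moment. -/
theorem sum_setLIntegral_le {Ω : Type*} [MeasurableSpace Ω] (ν : Measure Ω)
    [IsProbabilityMeasure ν] {d : ℕ} (hd : 0 < d) {p : (Fin d → Bool) → Ω → ℝ}
    (hp : ∀ ξ, Measurable (p ξ)) {A : (Fin d → Bool) → Set Ω}
    {y : Ω → EuclideanSpace ℝ (Fin d)} (hy : Measurable y) (hy1 : ∀ ω, ‖y ω‖ ≤ 1) {K x : ℝ}
    (hx : 0 ≤ x)
    (hK : ∀ ξ, ∫⁻ ω in A ξ, ENNReal.ofReal (p ξ ω ^ 2) ∂ν ≤ ENNReal.ofReal (Real.exp K)) :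
    ∑ ξ, ∫⁻ ω in A ξ ∩ {ω | x < |inner ℝ (cubeVertex hd ξ : EuclideanSpace ℝ (Fin d)) (y ω)|},
        ENNReal.ofReal (p ξ ω) ∂ν ≤
      2 ^ d * ENNReal.ofReal (3 / 2 * Real.exp (K / 2 - d * x ^ 2 / 4)) := by
  set B : (Fin d → Bool) → Set Ω := fun ξ =>
    {ω | x < |inner ℝ (cubeVertex hd ξ : EuclideanSpace ℝ (Fin d)) (y ω)|} with hBdef
  have hB : ∀ ξ, MeasurableSet (B ξ) := fun ξ =>
    measurableSet_lt measurable_const (by fun_prop)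
  -- Cauchy–Schwarz is used in the form q ≤ l q²/2 + 1/(2l). This weight balances the second moment
  -- exp(K) with the tail exp(-d x²/2): the two terms become 1/2 and 1 times exp(K/2 - d x²/4),
  -- hence the constant 3/2.
  set l : ℝ := Real.exp (-(K / 2) - d * x ^ 2 / 4) with hl
  have hl0 : 0 < l := Real.exp_pos _
  have hpt : ∀ q : ℝ, ENNReal.ofReal q ≤
      ENNReal.ofReal (l / 2) * ENNReal.ofReal (q ^ 2) + ENNReal.ofReal (1 / (2 * l)) := by
    intro q
    rw [← ENNReal.ofReal_mul (by positivity), ← ENNReal.ofReal_add (by positivity) (by positivity)]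
    refine ENNReal.ofReal_le_ofReal ?_
    have : l / 2 * q ^ 2 + 1 / (2 * l) - q = (l * q - 1) ^ 2 / (2 * l) := by field_simp; ring
    have : 0 ≤ (l * q - 1) ^ 2 / (2 * l) := by positivity
    linarith
  have h1 : ∀ ξ, ∫⁻ ω in A ξ ∩ B ξ, ENNReal.ofReal (p ξ ω) ∂ν ≤
      ENNReal.ofReal (l / 2) * ENNReal.ofReal (Real.exp K) +
        ENNReal.ofReal (1 / (2 * l)) * ν (B ξ) := by
    intro ξ
    calc _ ≤ ∫⁻ ω in A ξ ∩ B ξ, (ENNReal.ofReal (l / 2) * ENNReal.ofReal (p ξ ω ^ 2) +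
          ENNReal.ofReal (1 / (2 * l))) ∂ν := lintegral_mono fun ω => hpt _
      _ = ENNReal.ofReal (l / 2) * ∫⁻ ω in A ξ ∩ B ξ, ENNReal.ofReal (p ξ ω ^ 2) ∂ν +
          ENNReal.ofReal (1 / (2 * l)) * ν (A ξ ∩ B ξ) := by
          have := hp ξ
          rw [lintegral_add_right _ measurable_const, lintegral_const_mul _ (by fun_prop),
            setLIntegral_const]
      _ ≤ _ := by
          gcongr
          · exact (lintegral_mono_set Set.inter_subset_left).trans (hK ξ)
          · exact Set.inter_subset_right
  have h2 : ∑ ξ, ν (B ξ) ≤ 2 ^ d * ENNReal.ofReal (2 * Real.exp (-(d * x ^ 2) / 2)) := by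
    have : ∀ ξ, ν (B ξ) = ∫⁻ ω, (B ξ).indicator 1 ω ∂ν := fun ξ =>
      (lintegral_indicator_one (hB ξ)).symm
    simp_rw [this]
    rw [← lintegral_finsetSum _ fun ξ _ => measurable_one.indicator (hB ξ)]
    calc _ ≤ ∫⁻ _ω, 2 ^ d * ENNReal.ofReal (2 * Real.exp (-(d * x ^ 2) / 2)) ∂ν := by
          refine lintegral_mono fun ω => ?_
          have hc := ENNReal.ofReal_le_ofReal (card_cubeVertex_le hd hx (hy1 ω))
          rw [ENNReal.ofReal_mul (by positivity), ENNReal.ofReal_natCast,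
            ENNReal.ofReal_pow (by norm_num), ENNReal.ofReal_ofNat] at hc
          refine le_trans (le_of_eq ?_) hc
          simp only [Set.indicator_apply, Pi.one_apply, hBdef, Set.mem_ofPred_eq]
          rw [Finset.sum_ite, Finset.sum_const_zero, add_zero, Finset.sum_const, nsmul_eq_mul,
            mul_one]
      _ = _ := by simp
  calc _ ≤ ∑ ξ, (ENNReal.ofReal (l / 2) * ENNReal.ofReal (Real.exp K) +
        ENNReal.ofReal (1 / (2 * l)) * ν (B ξ)) := Finset.sum_le_sum fun ξ _ => h1 ξ
    _ = 2 ^ d * (ENNReal.ofReal (l / 2) * ENNReal.ofReal (Real.exp K)) +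
        ENNReal.ofReal (1 / (2 * l)) * ∑ ξ, ν (B ξ) := by
        rw [Finset.sum_add_distrib, Finset.sum_const, Finset.mul_sum]; simp
    _ ≤ 2 ^ d * (ENNReal.ofReal (l / 2) * ENNReal.ofReal (Real.exp K)) +
        ENNReal.ofReal (1 / (2 * l)) *
          (2 ^ d * ENNReal.ofReal (2 * Real.exp (-(d * x ^ 2) / 2))) := by gcongr
    _ = 2 ^ d * ENNReal.ofReal (3 / 2 * Real.exp (K / 2 - d * x ^ 2 / 4)) := by
        rw [mul_left_comm (ENNReal.ofReal (1 / (2 * l))), ← mul_add,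
          ← ENNReal.ofReal_mul (by positivity), ← ENNReal.ofReal_mul (by positivity),
          ← ENNReal.ofReal_add (by positivity) (by positivity)]
        congr 2
        have e1 : l * Real.exp K = Real.exp (K / 2 - d * x ^ 2 / 4) := by
          rw [hl, ← Real.exp_add]; congr 1; ring
        have e2 : Real.exp (-(d * x ^ 2) / 2) = l * Real.exp (K / 2 - d * x ^ 2 / 4) := by
          rw [hl, ← Real.exp_add]; congr 1; ring
        rw [e2, div_mul_eq_mul_div, e1]
        field_simp
        ring

/-! ### The envelope -/

theorem envelope_nonneg (f : ℝ → ℝ) (x : ℝ) : 0 ≤ envelope f x :=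
  (abs_nonneg _).trans (le_max_left _ _)

/-- For non-decreasing `f`, f(y) lies between f(-x) and f(x), which is why both signs enter
`envelope`. For even `f`, f(y) = f(|y|), and monotonicity on [0, 1] suffices. -/
theorem BurnInRegular.abs_le_envelope {f : ℝ → ℝ} (hf : BurnInRegular f) {x y : ℝ}
    (hyx : |y| ≤ x) (hx : x ≤ 1) : |f y| ≤ envelope f x := by
  obtain ⟨h1, h2⟩ := abs_le.mp hyx
  have hx0 : 0 ≤ x := (abs_nonneg y).trans hyx
  rcases hf.monotone with hm | ⟨he, hm⟩
  · have a1 := hm (a := y) (b := x) ⟨by linarith, by linarith⟩ ⟨by linarith, hx⟩ h2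
    have a2 := hm (a := -x) (b := y) ⟨by linarith, by linarith⟩ ⟨by linarith, by linarith⟩ h1
    rw [envelope, max_comm]
    exact abs_le_max_abs_abs a2 a1
  · have e : f y = f |y| := by
      rcases abs_choice y with h | h <;> rw [h]
      exact (he y ⟨by linarith, by linarith⟩).symm
    have a1 := hm (a := |y|) (b := x) ⟨abs_nonneg _, by linarith⟩ ⟨hx0, hx⟩ hyx
    have a2 := hm (a := 0) (b := |y|) ⟨le_rfl, by norm_num⟩ ⟨abs_nonneg _, by linarith⟩
      (abs_nonneg _)
    rw [hf.map_zero] at a2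
    rw [e, envelope, abs_of_nonneg a2]
    exact (a1.trans (le_abs_self _)).trans (le_max_left _ _)

theorem BurnInRegular.envelope_mono {f : ℝ → ℝ} (hf : BurnInRegular f) {x y : ℝ}
    (hx : 0 ≤ x) (hxy : x ≤ y) (hy : y ≤ 1) : envelope f x ≤ envelope f y :=
  max_le (hf.abs_le_envelope (by rwa [abs_of_nonneg hx]) hy)
    (hf.abs_le_envelope (by rwa [abs_neg, abs_of_nonneg hx]) hy)

/-- The squared correlation that a learner may reach after `t` rounds. -/
noncomputable def barrier (f : ℝ → ℝ) (d : ℕ) (u₀ : ℝ) : ℕ → ℝ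
  | 0 => u₀
  | t + 1 => barrier f d u₀ t + 2 / d * envelope f √(barrier f d u₀ t) ^ 2

theorem barrier_mono (f : ℝ → ℝ) (d : ℕ) (u₀ : ℝ) : Monotone (barrier f d u₀) := by
  refine monotone_nat_of_le_succ fun t => ?_
  rw [barrier]
  have : 0 ≤ 2 / (d : ℝ) * envelope f √(barrier f d u₀ t) ^ 2 := by positivity
  linarith

/-- Explains the factor 2/d in the recursion: in the exponent K/2 - d u_t/4 with K = ∑ g(√u_s)², the
growth of the barrier cancels K exactly and leaves -d u_0/4. -/
theorem mul_barrier (f : ℝ → ℝ) {d : ℕ} (hd : 0 < d) (u₀ : ℝ) (t : ℕ) :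
    d * barrier f d u₀ t =
      d * u₀ + 2 * ∑ s ∈ Finset.range t, envelope f √(barrier f d u₀ s) ^ 2 := by
  induction t with
  | zero => simp [barrier]
  | succ t ih =>
    rw [barrier, Finset.sum_range_succ, mul_add, ih]
    field_simp
    ring

theorem lintegral_two_mul {a b : ℝ} (ha : 0 ≤ a) (hab : a ≤ b) :
    ∫⁻ x in Set.Ioc a b, ENNReal.ofReal (2 * x) = ENNReal.ofReal (b ^ 2 - a ^ 2) := by
  rw [← ofReal_integral_eq_lintegral_ofReal]
  · rw [← intervalIntegral.integral_of_le hab]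
    congr 1
    rw [intervalIntegral.integral_const_mul, integral_id]
    ring
  · exact (Continuous.integrableOn_Icc (by fun_prop)).mono_set Set.Ioc_subset_Icc_self
  · refine (ae_restrict_mem measurableSet_Ioc).mono fun x hx => ?_
    have := hx.1
    show 0 ≤ 2 * x
    linarith

/-- The barrier moves at most at the speed prescribed by the burn-in differential equation. -/
theorem setLIntegral_le_of_barrier {f : ℝ → ℝ} (hf : BurnInRegular f) {d : ℕ} (hd : 0 < d)
    {u₀ : ℝ} (hu : 0 ≤ u₀) (t : ℕ) :
    ∫⁻ x in Set.Ioc √u₀ (min √(barrier f d u₀ t) (1 / 4)),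
      ENNReal.ofReal (2 * x) / ENNReal.ofReal (envelope f x ^ 2) ≤ t * ENNReal.ofReal (2 / d) := by
  induction t with
  | zero => simp [barrier]
  | succ t ih =>
    have hu0 : 0 ≤ barrier f d u₀ t := hu.trans (barrier_mono f d u₀ (Nat.zero_le t))
    set a := √(barrier f d u₀ t) with ha
    set b := √(barrier f d u₀ (t + 1)) with hb
    have ha0 : 0 ≤ a := Real.sqrt_nonneg _
    have hsub : Set.Ioc √u₀ (min b (1 / 4)) ⊆
        Set.Ioc √u₀ (min a (1 / 4)) ∪ Set.Ioc a (min b (1 / 4)) := by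
      intro x hx
      rcases le_or_gt x a with h | h
      · exact Or.inl ⟨hx.1, le_min h (hx.2.trans (min_le_right _ _))⟩
      · exact Or.inr ⟨h, hx.2⟩
    refine (lintegral_mono_set hsub).trans ((lintegral_union_le _ _ _).trans ?_)
    push_cast
    rw [add_mul, one_mul]
    refine add_le_add ih ?_
    rcases le_or_gt (min b (1 / 4)) a with h | h
    · rw [Set.Ioc_eq_empty (not_lt.mpr h)]; simp
    -- If the envelope vanishes at a, the barrier does not move and the new interval is empty.
    -- Otherwise monotonicity bounds the integrand by its value with g frozen at a.
    have hg : 0 < envelope f a := by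
      refine lt_of_le_of_ne (envelope_nonneg f a) fun h0 => ?_
      have : b = a := by rw [hb, barrier, ← ha, ← h0]; simp [ha]
      rw [this] at h
      exact absurd (min_le_left a (1 / 4)) (not_le.mpr h)
    calc ∫⁻ x in Set.Ioc a (min b (1 / 4)),
          ENNReal.ofReal (2 * x) / ENNReal.ofReal (envelope f x ^ 2)
        ≤ ∫⁻ x in Set.Ioc a (min b (1 / 4)),
          ENNReal.ofReal (2 * x) * (ENNReal.ofReal (envelope f a ^ 2))⁻¹ := by
          refine setLIntegral_mono' measurableSet_Ioc fun x hx => ?_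
          rw [div_eq_mul_inv]
          gcongr
          exact hf.envelope_mono ha0 hx.1.le (by linarith [hx.2.trans (min_le_right _ _)])
      _ = ENNReal.ofReal ((min b (1 / 4)) ^ 2 - a ^ 2) * (ENNReal.ofReal (envelope f a ^ 2))⁻¹ := by
          rw [lintegral_mul_const _ (by fun_prop), lintegral_two_mul ha0 h.le]
      _ ≤ ENNReal.ofReal (2 / d * envelope f a ^ 2) * (ENNReal.ofReal (envelope f a ^ 2))⁻¹ := by
          gcongr
          have h1 : (min b (1 / 4)) ^ 2 ≤ b ^ 2 :=
            pow_le_pow_left₀ (ha0.trans h.le) (min_le_left _ _) 2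
          have h2 : b ^ 2 = a ^ 2 + 2 / d * envelope f a ^ 2 := by
            rw [hb, ha, Real.sq_sqrt hu0, Real.sq_sqrt, barrier]
            exact hu.trans (barrier_mono f d u₀ (Nat.zero_le _))
          linarith
      _ = ENNReal.ofReal (2 / d) := by
          rw [ENNReal.ofReal_mul (by positivity), mul_assoc, ENNReal.mul_inv_cancel, mul_one]
          · simpa using hg.ne'
          · exact ENNReal.ofReal_ne_top

/-- If the barrier exceeded 1/16, its square root would have passed 1/4, and the whole integral
would already be at most 2t/d. -/
theorem barrier_le {f : ℝ → ℝ} (hf : BurnInRegular f) {d : ℕ} (hd : 0 < d)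
    {u₀ : ℝ} (hu : 0 ≤ u₀) {t : ℕ}
    (ht : t * ENNReal.ofReal (2 / d) < ∫⁻ x in Set.Ioc √u₀ (1 / 4),
      ENNReal.ofReal (2 * x) / ENNReal.ofReal (envelope f x ^ 2)) :
    barrier f d u₀ t ≤ 1 / 16 := by
  by_contra! h
  have h1 : (1 / 4 : ℝ) ≤ √(barrier f d u₀ t) := by
    refine Real.le_sqrt_of_sq_le ?_
    norm_num; linarith
  have := setLIntegral_le_of_barrier hf hd hu t
  rw [min_eq_right h1] at this
  exact absurd this (not_le.mpr ht)

/-! ### Burn-in -/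

theorem banditLaw_eq_withDensity {d : ℕ} (π : Policy d) {m : Ball d → ℝ} (hm : Measurable m)
    (t : ℕ) : banditLaw π m t =
      (banditLaw π 0 t).withDensity fun h => ENNReal.ofReal (likelihood m h) := by
  refine Measure.ext_of_lintegral _ fun G hG => ?_
  rw [lintegral_banditLaw π hm hG, lintegral_withDensity_eq_lintegral_mul _ (by fun_prop) hG]
  exact lintegral_congr fun h => mul_comm _ _

theorem abs_inner_le_one {d : ℕ} (θ : Sphere d) {y : EuclideanSpace ℝ (Fin d)} (hy : ‖y‖ ≤ 1) :
    |inner ℝ (θ : EuclideanSpace ℝ (Fin d)) y| ≤ 1 := by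
  have h := abs_real_inner_le_norm (θ : EuclideanSpace ℝ (Fin d)) y
  rw [mem_sphere_zero_iff_norm.mp θ.2, one_mul] at h
  exact h.trans hy

theorem norm_ball_le {d : ℕ} (a : Ball d) : ‖(a : EuclideanSpace ℝ (Fin d))‖ ≤ 1 :=
  mem_closedBall_zero_iff.mp a.2

theorem inner_mem_Icc {d : ℕ} (θ : Sphere d) (a : Ball d) :
    inner ℝ (θ : EuclideanSpace ℝ (Fin d)) (a : EuclideanSpace ℝ (Fin d)) ∈ Set.Icc (-1 : ℝ) 1 :=
  abs_le.mp (abs_inner_le_one θ (norm_ball_le a))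

/-- Specialises the change of measure to history laws: the reference measure is the law with zero
mean rewards, under which `y` carries no information on the vertex, and K is the sum of the squared
reward bounds. -/
theorem sum_historyLaw_inter_le {d : ℕ} (hd : 0 < d) {f : ℝ → ℝ}
    (hc : ContinuousOn f (Set.Icc (-1) 1)) (π : Policy d) {t : ℕ} {b : ℕ → ℝ}
    {S : (Fin d → Bool) → Set (History d t)} (hS : ∀ ξ, MeasurableSet (S ξ))
    (hSb : ∀ ξ, ∀ h ∈ S ξ, ∀ s : Fin t, |meanReward f (cubeVertex hd ξ) (h s).1| ≤ b s)
    {y : History d t → EuclideanSpace ℝ (Fin d)} (hy : Measurable y) (hy1 : ∀ h, ‖y h‖ ≤ 1)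
    {x : ℝ} (hx : 0 ≤ x) :
    ∑ ξ, historyLaw f π (cubeVertex hd ξ) t
      (S ξ ∩ {h | x < |inner ℝ (cubeVertex hd ξ : EuclideanSpace ℝ (Fin d)) (y h)|}) ≤
      2 ^ d * ENNReal.ofReal
        (3 / 2 * Real.exp ((∑ s ∈ Finset.range t, b s ^ 2) / 2 - d * x ^ 2 / 4)) := by
  have := isProbabilityMeasure_banditLaw π (m := 0) measurable_zero t
  have hm := fun ξ => measurable_meanReward hc (cubeVertex hd ξ)
  refine le_trans (le_of_eq ?_) (sum_setLIntegral_le (banditLaw π 0 t) hd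
    (fun ξ => measurable_likelihood (hm ξ)) (A := S) hy hy1 hx fun ξ =>
      (lintegral_mono_set ?_).trans (lintegral_likelihood_sq_le π (hm ξ) b t))
  · refine Finset.sum_congr rfl fun ξ _ => ?_
    rw [historyLaw_eq_banditLaw, banditLaw_eq_withDensity π (hm ξ), withDensity_apply]
    exact (hS ξ).inter (measurableSet_lt measurable_const (by fun_prop))
  · exact fun h hh => hSb ξ h hh

/-- The event that all correlations stay below the barrier. -/
def goodSet (f : ℝ → ℝ) {d : ℕ} (u₀ : ℝ) (θ : Sphere d) (t : ℕ) : Set (History d t) :=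
  {h | ∀ s : Fin t, |inner ℝ (θ : EuclideanSpace ℝ (Fin d)) ((h s).1 : EuclideanSpace ℝ (Fin d))| ≤
    √(barrier f d u₀ s)}

theorem measurableSet_goodSet (f : ℝ → ℝ) {d : ℕ} (u₀ : ℝ) (θ : Sphere d) (t : ℕ) :
    MeasurableSet (goodSet f u₀ θ t) := by
  rw [goodSet, Set.ofPred_forall]
  exact MeasurableSet.iInter fun s => measurableSet_le (by fun_prop) (by fun_prop)

theorem measurable_init {d t : ℕ} :
    Measurable fun h : History d (t + 1) => (Fin.init h : History d t) := by
  unfold Fin.init; fun_prop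

theorem map_init_historyLaw {d : ℕ} {f : ℝ → ℝ} (hc : ContinuousOn f (Set.Icc (-1) 1))
    (π : Policy d) (θ : Sphere d) (t : ℕ) :
    (historyLaw f π θ (t + 1)).map (fun h => (Fin.init h : History d t)) = historyLaw f π θ t := by
  rw [historyLaw_eq_banditLaw, historyLaw_eq_banditLaw,
    map_init_banditLaw π (measurable_meanReward hc θ)]

theorem sum_goodSet_inter_le {d : ℕ} (hd : 0 < d) {f : ℝ → ℝ} (hf : BurnInRegular f)
    (hc : ContinuousOn f (Set.Icc (-1) 1)) (π : Policy d) {u₀ : ℝ} (hu₀ : 0 ≤ u₀) {t : ℕ}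
    (ht : barrier f d u₀ t ≤ 1)
    {y : History d t → EuclideanSpace ℝ (Fin d)} (hy : Measurable y) (hy1 : ∀ h, ‖y h‖ ≤ 1) :
    ∑ ξ, historyLaw f π (cubeVertex hd ξ) t (goodSet f u₀ (cubeVertex hd ξ) t ∩
      {h | √(barrier f d u₀ t) < |inner ℝ (cubeVertex hd ξ : EuclideanSpace ℝ (Fin d)) (y h)|}) ≤
      2 ^ d * ENNReal.ofReal (3 / 2 * Real.exp (1 / 2 - d * u₀ / 4)) := by
  refine (sum_historyLaw_inter_le hd hc π (b := fun s => envelope f √(barrier f d u₀ s))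
    (fun ξ => measurableSet_goodSet f u₀ _ t) (fun ξ h hh s => ?_) hy hy1
    (Real.sqrt_nonneg _)).trans ?_
  · exact hf.abs_le_envelope (hh s)
      (Real.sqrt_le_one.mpr ((barrier_mono f d u₀ s.2.le).trans ht))
  -- The exponent is exactly -d u₀/4; the slack 1/2 is added to match the bound used for the
  -- actions.
  · rw [Real.sq_sqrt (hu₀.trans (barrier_mono f d u₀ (Nat.zero_le t))), mul_barrier f hd]
    gcongr 2 ^ d * ENNReal.ofReal (3 / 2 * Real.exp ?_)
    linarith

/-- Union bound over the first round that crosses the barrier. Round number t (counted from 0) is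
tested against u_t, which depends only on earlier rounds; so N + 1 rounds are controlled by u_N. -/
theorem sum_goodSet_compl_le {d : ℕ} (hd : 0 < d) {f : ℝ → ℝ} (hf : BurnInRegular f)
    (hc : ContinuousOn f (Set.Icc (-1) 1)) (π : Policy d) {u₀ : ℝ} (hu₀ : 0 ≤ u₀) {N t : ℕ}
    (hN : barrier f d u₀ N ≤ 1) (ht : t ≤ N + 1) :
    ∑ ξ, historyLaw f π (cubeVertex hd ξ) t (goodSet f u₀ (cubeVertex hd ξ) t)ᶜ ≤
      t * (2 ^ d * ENNReal.ofReal (3 / 2 * Real.exp (1 / 2 - d * u₀ / 4))) := by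
  induction t with
  | zero =>
    simp only [Nat.cast_zero, zero_mul, nonpos_iff_eq_zero, Finset.sum_eq_zero_iff]
    intro ξ _
    have : goodSet f u₀ (cubeVertex hd ξ) 0 = Set.univ :=
      Set.eq_univ_of_forall fun h s => s.elim0
    rw [this]; simp
  | succ t ih =>
    specialize ih (by omega)
    have htN : barrier f d u₀ t ≤ 1 := (barrier_mono f d u₀ (by omega)).trans hN
    -- The last action is the one that may cross, so its mean reward is bounded only by 1. This adds
    -- 1 to K and is the origin of the 1/2 in the exponent.
    set b : ℕ → ℝ := fun s => if s < t then envelope f √(barrier f d u₀ s) else 1 with hb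
    have hbsum : ∑ s ∈ Finset.range (t + 1), b s ^ 2 =
        ∑ s ∈ Finset.range t, envelope f √(barrier f d u₀ s) ^ 2 + 1 := by
      rw [Finset.sum_range_succ]
      congr 1
      · refine Finset.sum_congr rfl fun s hs => ?_
        rw [hb]; simp [Finset.mem_range.mp hs]
      · simp [hb]
    set S : (Fin d → Bool) → Set (History d (t + 1)) := fun ξ =>
      (fun h => (Fin.init h : History d t)) ⁻¹' goodSet f u₀ (cubeVertex hd ξ) t with hSdef
    have hS : ∀ ξ, MeasurableSet (S ξ) := fun ξ =>
      measurable_init (measurableSet_goodSet f u₀ _ t)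
    set y : History d (t + 1) → EuclideanSpace ℝ (Fin d) := fun h => (h (Fin.last t)).1 with hy
    have key := sum_historyLaw_inter_le hd hc π (b := b) hS (fun ξ h hh s => ?_)
      (y := y) (by fun_prop) (fun h => norm_ball_le _) (x := √(barrier f d u₀ t))
      (Real.sqrt_nonneg _)
    · have hsub : ∀ ξ, historyLaw f π (cubeVertex hd ξ) (t + 1)
            (goodSet f u₀ (cubeVertex hd ξ) (t + 1))ᶜ ≤
          historyLaw f π (cubeVertex hd ξ) t (goodSet f u₀ (cubeVertex hd ξ) t)ᶜ +
          historyLaw f π (cubeVertex hd ξ) (t + 1) (S ξ ∩ {h | √(barrier f d u₀ t) <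
            |inner ℝ (cubeVertex hd ξ : EuclideanSpace ℝ (Fin d)) (y h)|}) := by
        intro ξ
        rw [← map_init_historyLaw hc π _ t, Measure.map_apply measurable_init
          (measurableSet_goodSet f u₀ _ t).compl]
        refine (measure_mono fun h hh => ?_).trans (measure_union_le _ _)
        by_cases h1 : (Fin.init h : History d t) ∈ goodSet f u₀ (cubeVertex hd ξ) t
        · refine Or.inr ⟨h1, ?_⟩
          by_contra h2
          refine hh ?_
          rw [goodSet, Set.mem_ofPred_eq, Fin.forall_fin_succ']
          exact ⟨fun s => h1 s, not_lt.mp h2⟩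
        · exact Or.inl h1
      refine (Finset.sum_le_sum fun ξ _ => hsub ξ).trans ?_
      rw [Finset.sum_add_distrib]
      push_cast
      rw [add_mul, one_mul]
      refine add_le_add ih (key.trans ?_)
      rw [Real.sq_sqrt (hu₀.trans (barrier_mono f d u₀ (Nat.zero_le t))), mul_barrier f hd, hbsum]
      gcongr 2 ^ d * ENNReal.ofReal (3 / 2 * Real.exp ?_)
      linarith
    · refine Fin.lastCases ?_ (fun s => ?_) s
      · simpa [hb, meanReward] using hf.abs_le_one _ (inner_mem_Icc _ _)
      · have := hf.abs_le_envelope (hh s)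
          (Real.sqrt_le_one.mpr ((barrier_mono f d u₀ s.2.le).trans htN))
        simpa [hb, meanReward, Fin.init] using this

/-- The loss is affine in the estimate, so a randomized estimator may be replaced by its conditional
mean, a deterministic point of the unit ball. -/
theorem exists_condMean {d T : ℕ} (e : Estimator d T) :
    ∃ v : History d T → EuclideanSpace ℝ (Fin d), Measurable v ∧ (∀ h, ‖v h‖ ≤ 1) ∧
      ∀ (f : ℝ → ℝ) (π : Policy d) (θ : Sphere d), risk f π e θ =
        ∫ h, (1 - inner ℝ (θ : EuclideanSpace ℝ (Fin d)) (v h)) ∂(historyLaw f π θ T) := by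
  have := e.isMarkov
  have hn : ∀ v : Sphere d, ‖(v : EuclideanSpace ℝ (Fin d))‖ ≤ 1 := fun v =>
    (mem_sphere_zero_iff_norm.mp v.2).le
  have hI : ∀ h, Integrable (fun v : Sphere d => (v : EuclideanSpace ℝ (Fin d))) (e.estimate h) :=
    fun h => Integrable.of_bound (by fun_prop) 1 (Filter.Eventually.of_forall hn)
  refine ⟨fun h => ∫ v, (v : EuclideanSpace ℝ (Fin d)) ∂(e.estimate h), ?_, fun h => ?_,
    fun f π θ => ?_⟩
  · have : StronglyMeasurable (fun v : Sphere d => (v : EuclideanSpace ℝ (Fin d))) :=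
      measurable_subtype_coe.stronglyMeasurable
    exact this.integral_kernel.measurable
  · refine (norm_integral_le_of_norm_le_const (Filter.Eventually.of_forall hn)).trans ?_
    simp
  · unfold risk
    refine integral_congr_ae (Filter.Eventually.of_forall fun h => ?_)
    have h1 := integral_inner (𝕜 := ℝ) (hI h) (θ : EuclideanSpace ℝ (Fin d))
    have h2 : Integrable (fun v : Sphere d => inner ℝ (v : EuclideanSpace ℝ (Fin d))
        (θ : EuclideanSpace ℝ (Fin d))) (e.estimate h) := (hI h).inner_const _
    simp only
    rw [integral_sub (integrable_const _) h2, ← h1]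
    simp [real_inner_comm]

theorem exists_of_sum_ge {d : ℕ} {a : (Fin d → Bool) → ℝ} {r : ℝ} (h : 2 ^ d * r ≤ ∑ ξ, a ξ) :
    ∃ ξ, r ≤ a ξ := by
  obtain ⟨ξ, -, h1⟩ := Finset.exists_le_of_sum_le (s := Finset.univ) (f := fun _ => r) (g := a)
    Finset.univ_nonempty (by simpa using h)
  exact ⟨ξ, h1⟩

/-- This fixes c = 20: the exponent 20 log T / 4 makes each failure probability O(T⁻⁵), and at most
T of them sum to at most 3/T⁴ ≤ 3/16. -/
theorem fail_le {T k : ℕ} (hT : 2 ≤ T) (hk : k ≤ T) :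
    k * (3 / 2 * Real.exp (1 / 2 - 20 * Real.log T / 4)) ≤ 3 / 16 := by
  have hT' : (2 : ℝ) ≤ T := by exact_mod_cast hT
  have hk' : (k : ℝ) ≤ T := by exact_mod_cast hk
  have h1 : Real.exp (1 / 2 - 20 * Real.log T / 4) = Real.exp (1 / 2) / (T : ℝ) ^ 5 := by
    rw [Real.exp_sub, show 20 * Real.log T / 4 = (5 : ℕ) * Real.log T by push_cast; ring,
      Real.exp_nat_mul, Real.exp_log (by positivity)]
  have h2 : Real.exp (1 / 2) ≤ 2 := by
    rw [Real.exp_half]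
    refine Real.sqrt_le_iff.mpr ⟨by norm_num, ?_⟩
    linarith [Real.exp_one_lt_d9]
  rw [h1]
  have h4 : (16 : ℝ) ≤ (T : ℝ) ^ 4 := by
    calc (16 : ℝ) = 2 ^ 4 := by norm_num
      _ ≤ _ := by gcongr
  calc k * (3 / 2 * (Real.exp (1 / 2) / (T : ℝ) ^ 5)) ≤ T * (3 / 2 * (2 / (T : ℝ) ^ 5)) := by
        gcongr
    _ = 3 / (T : ℝ) ^ 4 := by field_simp
    _ ≤ 3 / 16 := by gcongr

theorem toReal_sum_le {d k : ℕ} {a : (Fin d → Bool) → ℝ≥0∞} {B : ℝ} (hB : 0 ≤ B)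
    (h : ∑ ξ, a ξ ≤ k * (2 ^ d * ENNReal.ofReal B)) : ∑ ξ, (a ξ).toReal ≤ 2 ^ d * (k * B) := by
  have hR : k * (2 ^ d * ENNReal.ofReal B) = ENNReal.ofReal (2 ^ d * (k * B)) := by
    rw [ENNReal.ofReal_mul (by positivity), ENNReal.ofReal_mul (by positivity),
      ENNReal.ofReal_natCast, ENNReal.ofReal_pow (by norm_num), ENNReal.ofReal_ofNat]
    ring
  rw [hR] at h
  have hfin : ∀ ξ ∈ Finset.univ, a ξ ≠ ⊤ := by
    rw [← ENNReal.sum_ne_top]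
    exact ne_top_of_le_ne_top ENNReal.ofReal_ne_top h
  rw [← ENNReal.toReal_sum hfin]
  exact ENNReal.toReal_le_of_le_ofReal (by positivity) h

/-- The estimate plays the role of an additional action after N rounds, giving N + 1 ≤ T events to
exclude. Off these events its correlation is at most 1/4, so the average risk is at least 3/4 - 3/16
≥ 1/2. -/
theorem exists_half_le_risk {d : ℕ} (hd : 0 < d) {f : ℝ → ℝ} (hf : BurnInRegular f)
    (hc : ContinuousOn f (Set.Icc (-1) 1)) {N T : ℕ} (hT : 2 ≤ T) (hNT : N < T)
    (hN : barrier f d (20 * Real.log T / d) N ≤ 1 / 16) (π : Policy d) (e : Estimator d N) :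
    ∃ θ, 1 / 2 ≤ risk f π e θ := by
  obtain ⟨v, hv, hv1, hrisk⟩ := exists_condMean e
  set u₀ := 20 * Real.log T / d with hu
  have hu₀ : 0 ≤ u₀ := by
    have : 0 ≤ Real.log T := Real.log_natCast_nonneg T
    positivity
  have hdu : d * u₀ = 20 * Real.log T := by rw [hu]; field_simp
  have hbar : √(barrier f d u₀ N) ≤ 1 / 4 := by
    refine Real.sqrt_le_iff.mpr ⟨by norm_num, ?_⟩
    norm_num; linarith
  set B := 3 / 2 * Real.exp (1 / 2 - 20 * Real.log T / 4) with hB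
  have h1 := sum_goodSet_compl_le hd hf hc π hu₀ (hN.trans (by norm_num)) N.le_succ
  have h2 := sum_goodSet_inter_le hd hf hc π hu₀ (hN.trans (by norm_num)) hv hv1
  rw [hdu, ← hB] at h1 h2
  set Z : (Fin d → Bool) → Set (History d N) := fun ξ => (goodSet f u₀ (cubeVertex hd ξ) N)ᶜ ∪
    (goodSet f u₀ (cubeVertex hd ξ) N ∩ {h | √(barrier f d u₀ N) <
      |inner ℝ (cubeVertex hd ξ : EuclideanSpace ℝ (Fin d)) (v h)|}) with hZ
  have hZm : ∀ ξ, MeasurableSet (Z ξ) := fun ξ => (measurableSet_goodSet f u₀ _ N).compl.union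
    ((measurableSet_goodSet f u₀ _ N).inter (measurableSet_lt measurable_const (by fun_prop)))
  have h3 : ∑ ξ, historyLaw f π (cubeVertex hd ξ) N (Z ξ) ≤
      (N + 1 : ℕ) * (2 ^ d * ENNReal.ofReal B) := by
    push_cast
    rw [add_mul, one_mul]
    refine (Finset.sum_le_sum fun ξ _ => measure_union_le _ _).trans ?_
    rw [Finset.sum_add_distrib]
    exact add_le_add h1 h2
  have h4 := toReal_sum_le (by positivity) h3
  have h5 := fail_le hT hNT
  rw [← hB] at h5
  have hlow : ∀ ξ, 3 / 4 - (historyLaw f π (cubeVertex hd ξ) N (Z ξ)).toReal ≤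
      risk f π e (cubeVertex hd ξ) := by
    intro ξ
    have := isProbabilityMeasure_historyLaw hc π (cubeVertex hd ξ) N
    rw [hrisk]
    have hind : Integrable ((Z ξ).indicator (fun _ => (1 : ℝ)))
        (historyLaw f π (cubeVertex hd ξ) N) := (integrable_const 1).indicator (hZm ξ)
    calc _ = ∫ h, (3 / 4 - (Z ξ).indicator (fun _ => (1 : ℝ)) h)
          ∂(historyLaw f π (cubeVertex hd ξ) N) := by
          rw [integral_sub (integrable_const _) hind, integral_indicator_const _ (hZm ξ)]
          simp [Measure.real]
      _ ≤ _ := by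
          refine integral_mono ((integrable_const _).sub hind) ?_ fun h => ?_
          · refine Integrable.of_bound (by fun_prop) 2 (Filter.Eventually.of_forall fun h => ?_)
            have := abs_le.mp (abs_inner_le_one (cubeVertex hd ξ) (hv1 h))
            rw [Real.norm_eq_abs, abs_le]
            constructor <;> linarith
          · have hin := abs_inner_le_one (cubeVertex hd ξ) (hv1 h)
            by_cases hz : h ∈ Z ξ
            · simp only [Set.indicator_of_mem hz]
              linarith [(abs_le.mp hin).2]
            · simp only [Set.indicator_of_notMem hz]
              have : |inner ℝ (cubeVertex hd ξ : EuclideanSpace ℝ (Fin d)) (v h)| ≤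
                  √(barrier f d u₀ N) := by
                by_contra hcon
                refine hz ?_
                by_cases hg : h ∈ goodSet f u₀ (cubeVertex hd ξ) N
                · exact Or.inr ⟨hg, not_le.mp hcon⟩
                · exact Or.inl hg
              linarith [(abs_le.mp this).2]
  obtain ⟨ξ, hξ⟩ := exists_of_sum_ge (a := fun ξ => risk f π e (cubeVertex hd ξ)) (r := 1 / 2) (by
    refine le_trans ?_ (Finset.sum_le_sum fun ξ _ => hlow ξ)
    rw [Finset.sum_sub_distrib]
    simp only [Finset.sum_const, Finset.card_univ, Fintype.card_fun, Fintype.card_bool,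
      Fintype.card_fin, nsmul_eq_mul]
    push_cast at h4 h5 ⊢
    have : (2 : ℝ) ^ d * ((N + 1) * B) ≤ 2 ^ d * (3 / 16) := by gcongr
    nlinarith [show (0 : ℝ) < 2 ^ d by positivity])
  exact ⟨_, hξ⟩

/-! ### Regularity and regret -/

theorem LipschitzRegular.continuousOn {f : ℝ → ℝ} {L : ℝ} (hL : LipschitzRegular f L) :
    ContinuousOn f (Set.Icc (-1) 1) := by
  have : LipschitzOnWith L.toNNReal f (Set.Icc (-1) 1) := by
    refine LipschitzOnWith.of_dist_le_mul fun x hx y hy => ?_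
    rw [Real.dist_eq, Real.dist_eq]
    exact (hL x hx y hy).trans (mul_le_mul_of_nonneg_right (Real.le_coe_toNNReal L) (abs_nonneg _))
  exact this.continuousOn

theorem LearningRegular.mul_sub_le {f : ℝ → ℝ} {cf Cf : ℝ} (hl : LearningRegular f cf Cf)
    {x y : ℝ} (hx : 1 / 10 ≤ x) (hxy : x ≤ y) (hy : y ≤ 1) : cf * (y - x) ≤ f y - f x := by
  refine (convex_Icc (1 / 10 : ℝ) 1).mul_sub_le_image_sub_of_le_deriv
    hl.differentiableOn.continuousOn (hl.differentiableOn.mono interior_subset) (fun z hz => ?_)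
    x ⟨hx, hxy.trans hy⟩ y ⟨hx.trans hxy, hy⟩ hxy
  rw [← derivWithin_of_mem_nhds (mem_interior_iff_mem_nhds.mp hz)]
  exact hl.le_deriv z (interior_subset hz)

theorem BurnInRegular.le_abs {f : ℝ → ℝ} (hf : BurnInRegular f) {x : ℝ}
    (hx : x ∈ Set.Icc (-1 : ℝ) 1) : f x ≤ f |x| := by
  rcases abs_cases x with ⟨h, -⟩ | ⟨h, h0⟩ <;> rw [h]
  rcases hf.monotone with hm | ⟨he, -⟩
  · exact hm hx ⟨by linarith [hx.2], by linarith [hx.1]⟩ (by linarith)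
  · exact (he x hx).ge

/-- For |x| ≥ 1/10 this is the slope bound. Below 1/10 monotonicity gives f(x) ≤ f(1/10) ≤ 1 -
(9/10) c_f, whence the factor 9/10. The absolute value covers even `f`. -/
theorem one_sub_ge {f : ℝ → ℝ} {cf Cf : ℝ} (hcf : 0 < cf) (hf : BurnInRegular f)
    (hl : LearningRegular f cf Cf) {x : ℝ} (hx : x ∈ Set.Icc (-1 : ℝ) 1) :
    9 / 10 * cf * (1 - |x|) ≤ 1 - f x := by
  have h1 := hf.le_abs hx
  have hx1 : |x| ≤ 1 := abs_le.mpr hx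
  have hx0 := abs_nonneg x
  rcases le_or_gt (1 / 10) |x| with h | h
  · have := hl.mul_sub_le h hx1 le_rfl
    rw [hf.map_one] at this
    nlinarith
  · have h2 := hl.mul_sub_le le_rfl (by norm_num) (le_refl (1 : ℝ))
    have h3 : f |x| ≤ f (1 / 10) := by
      rcases hf.monotone with hm | ⟨-, hm⟩
      · exact hm ⟨by linarith, hx1⟩ ⟨by norm_num, by norm_num⟩ h.le
      · exact hm ⟨hx0, hx1⟩ ⟨by norm_num, by norm_num⟩ h.le
    rw [hf.map_one] at h2
    nlinarith

theorem BurnInRegular.abs_meanReward_le {f : ℝ → ℝ} (hf : BurnInRegular f) {d : ℕ} (θ : Sphere d)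
    (a : Ball d) : |meanReward f θ a| ≤ 1 :=
  hf.abs_le_one _ (inner_mem_Icc θ a)

theorem BurnInRegular.iSup_meanReward {f : ℝ → ℝ} (hf : BurnInRegular f) {d : ℕ} (θ : Sphere d) :
    ⨆ a : Ball d, meanReward f θ a = 1 := by
  have : Nonempty (Ball d) := ⟨0, by simp⟩
  have hle : ∀ a : Ball d, meanReward f θ a ≤ 1 := fun a =>
    (le_abs_self _).trans (hf.abs_meanReward_le θ a)
  refine le_antisymm (ciSup_le hle) ?_
  have h := le_ciSup (f := fun a : Ball d => meanReward f θ a)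
    ⟨1, by rintro _ ⟨a, rfl⟩; exact hle a⟩
    ⟨θ, mem_closedBall_zero_iff.mpr (mem_sphere_zero_iff_norm.mp θ.2).le⟩
  refine le_trans (le_of_eq ?_) h
  simp [meanReward, mem_sphere_zero_iff_norm.mp θ.2, hf.map_one]

theorem BurnInRegular.regret_eq {f : ℝ → ℝ} (hf : BurnInRegular f) {d : ℕ} (π : Policy d)
    (θ : Sphere d) (T : ℕ) :
    regret f π θ T = ∫ h, ∑ t : Fin T, (1 - meanReward f θ (h t).1) ∂(historyLaw f π θ T) := by
  unfold regret
  rw [hf.iSup_meanReward]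
  simp

theorem integrable_regret {f : ℝ → ℝ} (hf : BurnInRegular f)
    (hc : ContinuousOn f (Set.Icc (-1) 1)) {d : ℕ} (π : Policy d) (θ : Sphere d) (T : ℕ) :
    Integrable (fun h : History d T => ∑ t : Fin T, (1 - meanReward f θ (h t).1))
      (historyLaw f π θ T) := by
  have := isProbabilityMeasure_historyLaw hc π θ T
  have hm := measurable_meanReward hc θ
  refine integrable_finsetSum _ fun t _ => Integrable.of_bound
    (measurable_const.sub (hm.comp (by fun_prop))).aestronglyMeasurable 2
    (Filter.Eventually.of_forall fun h => ?_)
  have := abs_le.mp (hf.abs_meanReward_le θ (h t).1)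
  rw [Real.norm_eq_abs, abs_le]
  constructor <;> linarith

theorem regret_le {f : ℝ → ℝ} (hf : BurnInRegular f) (hc : ContinuousOn f (Set.Icc (-1) 1))
    {d : ℕ} (π : Policy d) (θ : Sphere d) (T : ℕ) : regret f π θ T ≤ T * 2 := by
  have := isProbabilityMeasure_historyLaw hc π θ T
  rw [hf.regret_eq]
  calc _ ≤ ∫ _h, (T * 2 : ℝ) ∂(historyLaw f π θ T) := by
        refine integral_mono (integrable_regret hf hc π θ T) (integrable_const _) fun h => ?_
        calc _ ≤ ∑ _t : Fin T, (2 : ℝ) := Finset.sum_le_sum fun t _ => by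
              linarith [(abs_le.mp (hf.abs_meanReward_le θ (h t).1)).1]
          _ = _ := by simp
    _ = _ := by simp

/-- The maximal mean reward is 1, so each round adds a nonnegative term, and the history laws are
consistent under forgetting the last round. -/
theorem regret_le_succ {f : ℝ → ℝ} (hf : BurnInRegular f) (hc : ContinuousOn f (Set.Icc (-1) 1))
    {d : ℕ} (π : Policy d) (θ : Sphere d) (T : ℕ) : regret f π θ T ≤ regret f π θ (T + 1) := by
  have hm := measurable_meanReward hc θ
  have hI := integrable_regret hf hc π θ T
  rw [hf.regret_eq, hf.regret_eq]
  rw [← map_init_historyLaw hc π θ T] at hI ⊢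
  rw [integral_map measurable_init.aemeasurable hI.aestronglyMeasurable]
  refine integral_mono (hI.comp_measurable measurable_init) (integrable_regret hf hc π θ (T + 1))
    fun h => ?_
  simp only
  rw [Fin.sum_univ_castSucc]
  have : 0 ≤ 1 - meanReward f θ (h (Fin.last T)).1 := by
    linarith [(abs_le.mp (hf.abs_meanReward_le θ (h (Fin.last T)).1)).2]
  exact le_add_of_nonneg_right this

theorem regret_mono {f : ℝ → ℝ} (hf : BurnInRegular f) (hc : ContinuousOn f (Set.Icc (-1) 1))
    {d : ℕ} (π : Policy d) (θ : Sphere d) : Monotone (regret f π θ) :=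
  monotone_nat_of_le_succ (regret_le_succ hf hc π θ)

instance {d : ℕ} : Nonempty (Policy d) :=
  ⟨⟨fun _ => Kernel.const _ (Measure.dirac ⟨0, by simp⟩), fun _ => inferInstance⟩⟩

theorem nonempty_estimator {d : ℕ} (hd : 0 < d) (T : ℕ) : Nonempty (Estimator d T) :=
  ⟨⟨Kernel.const _ (Measure.dirac (cubeVertex hd fun _ => true)), inferInstance⟩⟩

theorem le_minimaxRegret {f : ℝ → ℝ} (hf : BurnInRegular f)
    (hc : ContinuousOn f (Set.Icc (-1) 1)) {d T : ℕ} {r : ℝ}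
    (h : ∀ π : Policy d, ∃ θ, r ≤ regret f π θ T) : r ≤ minimaxRegret f d T := by
  refine le_ciInf fun π => ?_
  obtain ⟨θ, hθ⟩ := h π
  -- A real supremum is bounded below by a member only once the family is known to be bounded above;
  -- the trivial bound 2T serves.
  exact hθ.trans (le_ciSup (f := fun θ => regret f π θ T)
    ⟨T * 2, by rintro _ ⟨θ, rfl⟩; exact regret_le hf hc π θ T⟩ θ)

theorem risk_le {f : ℝ → ℝ} (hc : ContinuousOn f (Set.Icc (-1) 1)) {d T : ℕ} (π : Policy d)
    (e : Estimator d T) (θ : Sphere d) : risk f π e θ ≤ 2 := by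
  obtain ⟨v, hv, hv1, hrisk⟩ := exists_condMean e
  have := isProbabilityMeasure_historyLaw hc π θ T
  rw [hrisk]
  have hb : ∀ h, |inner ℝ (θ : EuclideanSpace ℝ (Fin d)) (v h)| ≤ 1 := fun h =>
    abs_inner_le_one θ (hv1 h)
  calc _ ≤ ∫ _h, (2 : ℝ) ∂(historyLaw f π θ T) := by
        refine integral_mono (Integrable.of_bound (by fun_prop) 2
          (Filter.Eventually.of_forall fun h => ?_)) (integrable_const _) fun h => ?_
        · have := abs_le.mp (hb h)
          rw [Real.norm_eq_abs, abs_le]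
          constructor <;> linarith
        · linarith [(abs_le.mp (hb h)).1]
    _ = _ := by simp

theorem le_minimaxRisk {f : ℝ → ℝ} (hc : ContinuousOn f (Set.Icc (-1) 1)) {d T : ℕ} (hd : 0 < d)
    {r : ℝ} (h : ∀ (π : Policy d) (e : Estimator d T), ∃ θ, r ≤ risk f π e θ) :
    r ≤ minimaxRisk f d T := by
  have := nonempty_estimator hd T
  refine le_ciInf fun p => ?_
  obtain ⟨θ, hθ⟩ := h p.1 p.2
  exact hθ.trans (le_ciSup (f := fun θ => risk f p.1 p.2 θ)
    ⟨2, by rintro _ ⟨θ, rfl⟩; exact risk_le hc p.1 p.2 θ⟩ θ)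

/-- Every round of the burn-in phase costs a constant regret. -/
theorem mul_le_minimaxRegret_of_barrier {f : ℝ → ℝ} {cf Cf : ℝ} (hcf : 0 < cf)
    (hf : BurnInRegular f) (hl : LearningRegular f cf Cf) (hc : ContinuousOn f (Set.Icc (-1) 1))
    {d : ℕ} (hd : 0 < d) {N T : ℕ} (hT : 2 ≤ T) (hNT : N + 1 ≤ T)
    (hN : barrier f d (20 * Real.log T / d) N ≤ 1 / 16) :
    cf / 2 * (N + 1 : ℕ) ≤ minimaxRegret f d T := by
  refine le_minimaxRegret hf hc fun π => ?_
  set u₀ := 20 * Real.log T / d with hu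
  have hu₀ : 0 ≤ u₀ := by
    have : 0 ≤ Real.log T := Real.log_natCast_nonneg T
    positivity
  have hdu : d * u₀ = 20 * Real.log T := by rw [hu]; field_simp
  set B := 3 / 2 * Real.exp (1 / 2 - 20 * Real.log T / 4) with hB
  have hbar : ∀ s : Fin (N + 1), √(barrier f d u₀ s) ≤ 1 / 4 := by
    intro s
    refine Real.sqrt_le_iff.mpr ⟨by norm_num, ?_⟩
    have := barrier_mono f d u₀ (Nat.lt_succ_iff.mp s.2)
    norm_num; linarith
  have h1 : ∑ ξ, historyLaw f π (cubeVertex hd ξ) (N + 1)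
      (goodSet f u₀ (cubeVertex hd ξ) (N + 1))ᶜ ≤
      (N + 1 : ℕ) * (2 ^ d * ENNReal.ofReal (3 / 2 * Real.exp (1 / 2 - d * u₀ / 4))) :=
    sum_goodSet_compl_le hd hf hc π hu₀ (hN.trans (by norm_num)) le_rfl
  rw [hdu, ← hB] at h1
  have h4 := toReal_sum_le (by positivity) h1
  have h5 := fail_le hT hNT
  rw [← hB] at h5
  set Z : (Fin d → Bool) → Set (History d (N + 1)) := fun ξ =>
    (goodSet f u₀ (cubeVertex hd ξ) (N + 1))ᶜ with hZ
  have hZm : ∀ ξ, MeasurableSet (Z ξ) := fun ξ => (measurableSet_goodSet f u₀ _ _).compl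
  -- On the good event all correlations are at most 1/4, so each round costs at least (9/10) c_f ·
  -- (3/4). On the complement nonnegativity suffices.
  have hlow : ∀ ξ, 27 / 40 * cf * (N + 1 : ℕ) *
      (1 - (historyLaw f π (cubeVertex hd ξ) (N + 1) (Z ξ)).toReal) ≤
      regret f π (cubeVertex hd ξ) T := by
    intro ξ
    refine le_trans ?_ (regret_mono hf hc π (cubeVertex hd ξ) hNT)
    have := isProbabilityMeasure_historyLaw hc π (cubeVertex hd ξ) (N + 1)
    rw [hf.regret_eq]
    have hind : Integrable ((Z ξ).indicator (fun _ => (1 : ℝ)))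
        (historyLaw f π (cubeVertex hd ξ) (N + 1)) := (integrable_const 1).indicator (hZm ξ)
    calc _ = ∫ h, 27 / 40 * cf * (N + 1 : ℕ) * (1 - (Z ξ).indicator (fun _ => (1 : ℝ)) h)
          ∂(historyLaw f π (cubeVertex hd ξ) (N + 1)) := by
          rw [integral_const_mul, integral_sub (integrable_const _) hind,
            integral_indicator_const _ (hZm ξ)]
          simp [Measure.real]
      _ ≤ _ := by
          refine integral_mono (((integrable_const _).sub hind).const_mul _)
            (integrable_regret hf hc π _ _) fun h => ?_
          by_cases hz : h ∈ Z ξ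
          · simp only [Set.indicator_of_mem hz, sub_self, mul_zero]
            refine Finset.sum_nonneg fun t _ => ?_
            linarith [(abs_le.mp (hf.abs_meanReward_le (cubeVertex hd ξ) (h t).1)).2]
          · simp only [Set.indicator_of_notMem hz, sub_zero, mul_one]
            calc _ = ∑ _t : Fin (N + 1), 27 / 40 * cf := by simp; ring
              _ ≤ _ := by
                refine Finset.sum_le_sum fun t _ => ?_
                have hg := (Set.notMem_compl_iff.mp hz) t
                have := one_sub_ge hcf hf hl (inner_mem_Icc (cubeVertex hd ξ) (h t).1)
                refine le_trans ?_ this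
                nlinarith [hbar t]
  obtain ⟨ξ, hξ⟩ := exists_of_sum_ge (a := fun ξ => regret f π (cubeVertex hd ξ) T)
    (r := cf / 2 * (N + 1 : ℕ)) (by
    refine le_trans ?_ (Finset.sum_le_sum fun ξ _ => hlow ξ)
    rw [← Finset.mul_sum, Finset.sum_sub_distrib]
    simp only [Finset.sum_const, Finset.card_univ, Fintype.card_fun, Fintype.card_bool,
      Fintype.card_fin, nsmul_eq_mul]
    have h6 : (2 : ℝ) ^ d * ((N + 1 : ℕ) * B) ≤ 2 ^ d * (3 / 16) := by gcongr
    have h7 : (2 : ℝ) ^ d * (13 / 16) ≤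
        ((2 ^ d : ℕ) : ℝ) * 1 - ∑ ξ, (historyLaw f π (cubeVertex hd ξ) (N + 1) (Z ξ)).toReal := by
      push_cast
      linarith
    -- (27/40) · (13/16) exceeds 1/2.
    calc (2 : ℝ) ^ d * (cf / 2 * (N + 1 : ℕ)) ≤
          27 / 40 * cf * (N + 1 : ℕ) * ((2 : ℝ) ^ d * (13 / 16)) := by
          have : (0 : ℝ) ≤ 2 ^ d * (cf * (N + 1 : ℕ)) := by positivity
          nlinarith
      _ ≤ _ := by gcongr)
  exact ⟨_, hξ⟩

/-! ### Learning phase -/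

/-- The sign vector with the `i`-th sign flipped. -/
def flipAt {n : ℕ} (i : Fin n) (ξ : Fin n → Bool) : Fin n → Bool := Function.update ξ i (!ξ i)

theorem flipAt_involutive {n : ℕ} (i : Fin n) : Function.Involutive (flipAt i) := by
  intro ξ
  simp [flipAt]

theorem sgn_flipAt {n : ℕ} (i : Fin n) (ξ : Fin n → Bool) : sgn (flipAt i ξ i) = -sgn (ξ i) := by
  cases h : ξ i <;> simp [flipAt, sgn, h]

theorem flipAt_of_ne {n : ℕ} {i j : Fin n} (h : j ≠ i) (ξ : Fin n → Bool) :
    flipAt i ξ j = ξ j := by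
  simp [flipAt, h]

theorem sum_flipAt {n : ℕ} (i : Fin n) (F : (Fin n → Bool) → ℝ) :
    ∑ ξ, F (flipAt i ξ) = ∑ ξ, F ξ :=
  Equiv.sum_comp (flipAt_involutive i).toPerm F

/-- Points of the sphere at the vertices of a small cube around the north pole. -/
noncomputable def capVertex {n : ℕ} {δ : ℝ} (hδ : n * δ ^ 2 ≤ 1) (ξ : Fin n → Bool) :
    Sphere (n + 1) :=
  ⟨WithLp.toLp 2 (Fin.cons √(1 - n * δ ^ 2) fun i => δ * sgn (ξ i)), by
    rw [mem_sphere_zero_iff_norm, EuclideanSpace.norm_eq, Fin.sum_univ_succ]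
    simp [mul_pow, sgn_sq, Real.sq_sqrt (sub_nonneg.mpr hδ)]⟩

theorem capVertex_zero {n : ℕ} {δ : ℝ} (hδ : n * δ ^ 2 ≤ 1) (ξ : Fin n → Bool) :
    (capVertex hδ ξ : EuclideanSpace ℝ (Fin (n + 1))) 0 = √(1 - n * δ ^ 2) := rfl

theorem capVertex_succ {n : ℕ} {δ : ℝ} (hδ : n * δ ^ 2 ≤ 1) (ξ : Fin n → Bool) (i : Fin n) :
    (capVertex hδ ξ : EuclideanSpace ℝ (Fin (n + 1))) i.succ = δ * sgn (ξ i) := rfl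

theorem inner_capVertex {n : ℕ} {δ : ℝ} (hδ : n * δ ^ 2 ≤ 1) (ξ : Fin n → Bool)
    (y : EuclideanSpace ℝ (Fin (n + 1))) :
    inner ℝ (capVertex hδ ξ : EuclideanSpace ℝ (Fin (n + 1))) y =
      √(1 - n * δ ^ 2) * y 0 + ∑ i : Fin n, δ * sgn (ξ i) * y i.succ := by
  rw [PiLp.inner_apply, Fin.sum_univ_succ, capVertex_zero]
  simp only [capVertex_succ, RCLike.inner_apply, conj_trivial]
  congr 1
  · ring
  · exact Finset.sum_congr rfl fun i _ => by ring

theorem abs_coord_le_one {d : ℕ} {y : EuclideanSpace ℝ (Fin d)} (hy : ‖y‖ ≤ 1) (i : Fin d) :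
    |y i| ≤ 1 := (PiLp.norm_apply_le y i).trans hy

/-- Write p - q = (√p - √q)(√p + √q) and complete the square. This trades the correlation with one
sign for a part of the squared norm and a Hellinger term. -/
theorem mul_sub_mul_le {δ β σ v p q : ℝ} (hβ : 0 < β) (hσ : σ ^ 2 = 1) (hp : 0 ≤ p) (hq : 0 ≤ q) :
    δ * σ * v * (p - q) / 2 ≤
      β / 2 * (v ^ 2 * p + v ^ 2 * q) + δ ^ 2 / (4 * β) * (√p - √q) ^ 2 := by
  set P := √p with hP
  set Q := √q with hQ
  have hp2 : p = P ^ 2 := (Real.sq_sqrt hp).symm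
  have hq2 : q = Q ^ 2 := (Real.sq_sqrt hq).symm
  rw [hp2, hq2]
  have h1 : β / 2 * (v ^ 2 * P ^ 2 + v ^ 2 * Q ^ 2) + δ ^ 2 / (4 * β) * (P - Q) ^ 2 -
      δ * σ * v * (P ^ 2 - Q ^ 2) / 2 =
      (β * v * (P + Q) - δ * σ * (P - Q)) ^ 2 / (4 * β) + β / 4 * v ^ 2 * (P - Q) ^ 2 := by
    field_simp
    linear_combination (-(δ ^ 2 * (P - Q) ^ 2) * 2) * hσ
  have h2 : 0 ≤ (β * v * (P + Q) - δ * σ * (P - Q)) ^ 2 / (4 * β) +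
    β / 4 * v ^ 2 * (P - Q) ^ 2 := by positivity
  linarith

theorem sq_sqrt_sub_sqrt_le {p q : ℝ} (hp : 0 ≤ p) (hq : 0 ≤ q) : (√p - √q) ^ 2 ≤ p + q := by
  rw [sub_sq, Real.sq_sqrt hp, Real.sq_sqrt hq]
  have : 0 ≤ √p * √q := by positivity
  linarith

/-- A bound for the correlation of any estimator with a random vertex of a small cube around the
north pole, in terms of Hellinger distances. -/
theorem sum_integral_mul_inner_le {Ω : Type*} [MeasurableSpace Ω] (ν : Measure Ω) {n : ℕ} {δ : ℝ}
    (hδ : n * δ ^ 2 ≤ 1) {p : (Fin n → Bool) → Ω → ℝ} (hp0 : ∀ ξ ω, 0 ≤ p ξ ω)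
    (hpm : ∀ ξ, Measurable (p ξ)) (hpi : ∀ ξ, Integrable (p ξ) ν) (hp1 : ∀ ξ, ∫ ω, p ξ ω ∂ν = 1)
    {v : Ω → EuclideanSpace ℝ (Fin (n + 1))} (hv : Measurable v) (hv1 : ∀ ω, ‖v ω‖ ≤ 1)
    {β : ℝ} (hβ : 0 < β) :
    ∑ ξ, ∫ ω, p ξ ω * inner ℝ (capVertex hδ ξ : EuclideanSpace ℝ (Fin (n + 1))) (v ω) ∂ν ≤
      2 ^ n * (β + (1 - n * δ ^ 2) / (4 * β)) + δ ^ 2 / (4 * β) *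
        ∑ ξ, ∑ i, ∫ ω, (√(p ξ ω) - √(p (flipAt i ξ) ω)) ^ 2 ∂ν := by
  have hIb : ∀ (ξ) (g : Ω → ℝ), Measurable g → (∀ ω, |g ω| ≤ 1) →
      Integrable (fun ω => g ω * p ξ ω) ν := fun ξ g hg hg1 =>
    (hpi ξ).bdd_mul hg.aestronglyMeasurable (Filter.Eventually.of_forall hg1)
  have hvm : ∀ i, Measurable fun ω => v ω i := fun i => by fun_prop
  have hvb : ∀ i ω, |v ω i| ≤ 1 := fun i ω => abs_coord_le_one (hv1 ω) i
  have hI1 : ∀ ξ i, Integrable (fun ω => v ω i * p ξ ω) ν := fun ξ i => hIb ξ _ (hvm i) (hvb i)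
  have hI2 : ∀ ξ i, Integrable (fun ω => v ω i ^ 2 * p ξ ω) ν := fun ξ i =>
    hIb ξ _ ((hvm i).pow_const 2) fun ω => by
      rw [abs_pow]; exact pow_le_one₀ (abs_nonneg _) (hvb i ω)
  have hIH : ∀ ξ i, Integrable (fun ω => (√(p ξ ω) - √(p (flipAt i ξ) ω)) ^ 2) ν := by
    intro ξ i
    have := hpm ξ
    have := hpm (flipAt i ξ)
    refine ((hpi ξ).add (hpi (flipAt i ξ))).mono' (by fun_prop)
      (Filter.Eventually.of_forall fun ω => ?_)
    rw [Real.norm_of_nonneg (sq_nonneg _)]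
    exact sq_sqrt_sub_sqrt_le (hp0 _ _) (hp0 _ _)
  have hcoord : ∀ i : Fin n, ∑ ξ, δ * sgn (ξ i) * ∫ ω, v ω i.succ * p ξ ω ∂ν ≤
      β * ∑ ξ, ∫ ω, v ω i.succ ^ 2 * p ξ ω ∂ν +
        δ ^ 2 / (4 * β) * ∑ ξ, ∫ ω, (√(p ξ ω) - √(p (flipAt i ξ) ω)) ^ 2 ∂ν := by
    intro i
    have e1 : ∑ ξ, δ * sgn (ξ i) * ∫ ω, v ω i.succ * p ξ ω ∂ν =
        ∑ ξ, ∫ ω, δ * sgn (ξ i) * v ω i.succ * (p ξ ω - p (flipAt i ξ) ω) / 2 ∂ν := by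
      -- Averaging each term with that of the flipped vertex reverses the sign of ξ_i and produces
      -- the difference of the two densities.
      have hflip := sum_flipAt i fun ξ => δ * sgn (ξ i) * ∫ ω, v ω i.succ * p ξ ω ∂ν
      have e2 : ∀ ξ : Fin n → Bool,
          ∫ ω, δ * sgn (ξ i) * v ω i.succ * (p ξ ω - p (flipAt i ξ) ω) / 2 ∂ν =
          (1 / 2) * (δ * sgn (ξ i) * ∫ ω, v ω i.succ * p ξ ω ∂ν) + (1 / 2) *
            (δ * sgn (flipAt i ξ i) * ∫ ω, v ω i.succ * p (flipAt i ξ) ω ∂ν) := by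
        intro ξ
        have e3 : ∀ ω, δ * sgn (ξ i) * v ω i.succ * (p ξ ω - p (flipAt i ξ) ω) / 2 =
            δ * sgn (ξ i) / 2 * (v ω i.succ * p ξ ω - v ω i.succ * p (flipAt i ξ) ω) := by
          intro ω; ring
        simp_rw [e3]
        rw [integral_const_mul, integral_sub (hI1 _ _) (hI1 _ _), sgn_flipAt]
        ring
      simp_rw [e2]
      rw [Finset.sum_add_distrib, ← Finset.mul_sum, ← Finset.mul_sum, hflip]
      ring
    have e4 : ∑ ξ, ∫ ω, δ * sgn (ξ i) * v ω i.succ * (p ξ ω - p (flipAt i ξ) ω) / 2 ∂ν ≤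
        ∑ ξ, (β / 2 * (∫ ω, v ω i.succ ^ 2 * p ξ ω ∂ν +
          ∫ ω, v ω i.succ ^ 2 * p (flipAt i ξ) ω ∂ν) +
          δ ^ 2 / (4 * β) * ∫ ω, (√(p ξ ω) - √(p (flipAt i ξ) ω)) ^ 2 ∂ν) := by
      refine Finset.sum_le_sum fun ξ _ => ?_
      have hI3 : Integrable (fun ω => β / 2 * (v ω i.succ ^ 2 * p ξ ω +
          v ω i.succ ^ 2 * p (flipAt i ξ) ω)) ν := ((hI2 _ _).add (hI2 _ _)).const_mul _
      have hI4 := (hIH ξ i).const_mul (δ ^ 2 / (4 * β))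
      rw [← integral_add (hI2 _ _) (hI2 _ _), ← integral_const_mul, ← integral_const_mul,
        ← integral_add hI3 hI4]
      refine integral_mono ?_ (hI3.add hI4)
        fun ω => mul_sub_mul_le hβ (sgn_sq _) (hp0 _ _) (hp0 _ _)
      have := ((hI1 ξ i.succ).sub (hI1 (flipAt i ξ) i.succ)).const_mul (δ * sgn (ξ i) / 2)
      refine this.congr (Filter.Eventually.of_forall fun ω => ?_)
      simp only [Pi.sub_apply]
      ring
    rw [e1]
    refine e4.trans (le_of_eq ?_)
    rw [Finset.sum_add_distrib, ← Finset.mul_sum, ← Finset.mul_sum, Finset.sum_add_distrib,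
      sum_flipAt i fun ξ => ∫ ω, v ω i.succ ^ 2 * p ξ ω ∂ν]
    ring
  -- The polar coordinate is common to all vertices, so the arithmetic–geometric inequality is
  -- enough. It uses the same weight β, so that the squared coordinates add up to at most 1.
  have hzero : ∀ ξ, √(1 - n * δ ^ 2) * ∫ ω, v ω 0 * p ξ ω ∂ν ≤
      β * ∫ ω, v ω 0 ^ 2 * p ξ ω ∂ν + (1 - n * δ ^ 2) / (4 * β) := by
    intro ξ
    calc _ ≤ ∫ ω, (β * (v ω 0 ^ 2 * p ξ ω) + (1 - n * δ ^ 2) / (4 * β) * p ξ ω) ∂ν := by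
          rw [← integral_const_mul]
          refine integral_mono ((hI1 _ _).const_mul _)
            (((hI2 _ _).const_mul _).add ((hpi ξ).const_mul _)) fun ω => ?_
          have h1 : √(1 - n * δ ^ 2) * v ω 0 ≤ β * v ω 0 ^ 2 + (1 - n * δ ^ 2) / (4 * β) := by
            have h2 := Real.sq_sqrt (sub_nonneg.mpr hδ)
            have h3 : β * v ω 0 ^ 2 + (1 - n * δ ^ 2) / (4 * β) - √(1 - n * δ ^ 2) * v ω 0 =
                (2 * β * v ω 0 - √(1 - n * δ ^ 2)) ^ 2 / (4 * β) := by
              rw [sub_sq, h2]; field_simp; ring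
            have h4 : 0 ≤ (2 * β * v ω 0 - √(1 - n * δ ^ 2)) ^ 2 / (4 * β) := by positivity
            linarith
          have := mul_le_mul_of_nonneg_right h1 (hp0 ξ ω)
          simp only
          linarith
      _ = _ := by
          rw [integral_add ((hI2 _ _).const_mul _) ((hpi ξ).const_mul _), integral_const_mul,
            integral_const_mul, hp1, mul_one]
  have hsplit : ∀ ξ, ∫ ω, p ξ ω * inner ℝ (capVertex hδ ξ : EuclideanSpace ℝ (Fin (n + 1)))
      (v ω) ∂ν = √(1 - n * δ ^ 2) * ∫ ω, v ω 0 * p ξ ω ∂ν +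
        ∑ i : Fin n, δ * sgn (ξ i) * ∫ ω, v ω i.succ * p ξ ω ∂ν := by
    intro ξ
    simp_rw [← integral_const_mul]
    have hI3 : ∀ i ∈ (Finset.univ : Finset (Fin n)),
        Integrable (fun ω => δ * sgn (ξ i) * (v ω i.succ * p ξ ω)) ν :=
      fun i _ => (hI1 _ _).const_mul _
    rw [← integral_finsetSum _ hI3,
      ← integral_add ((hI1 _ _).const_mul _) (integrable_finsetSum _ hI3)]
    refine integral_congr_ae (Filter.Eventually.of_forall fun ω => ?_)
    simp only [inner_capVertex, mul_add, Finset.mul_sum]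
    congr 1
    · ring
    · exact Finset.sum_congr rfl fun i _ => by ring
  have hnorm : ∀ ξ, ∫ ω, v ω 0 ^ 2 * p ξ ω ∂ν + ∑ i : Fin n, ∫ ω, v ω i.succ ^ 2 * p ξ ω ∂ν ≤ 1 := by
    intro ξ
    have hI3 : ∀ i ∈ (Finset.univ : Finset (Fin n)),
        Integrable (fun ω => v ω i.succ ^ 2 * p ξ ω) ν := fun i _ => hI2 _ _
    rw [← integral_finsetSum _ hI3, ← integral_add (hI2 _ _) (integrable_finsetSum _ hI3), ← hp1 ξ]
    refine integral_mono ((hI2 _ _).add (integrable_finsetSum _ hI3)) (hpi ξ) fun ω => ?_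
    have h1 := sum_sq_le_one (hv1 ω)
    rw [Fin.sum_univ_succ] at h1
    simp only
    rw [← Finset.sum_mul, ← add_mul]
    exact mul_le_of_le_one_left (hp0 ξ ω) h1
  simp_rw [hsplit]
  rw [Finset.sum_add_distrib, Finset.sum_comm, Finset.sum_comm (f := fun ξ i =>
    ∫ ω, (√(p ξ ω) - √(p (flipAt i ξ) ω)) ^ 2 ∂ν)]
  calc _ ≤ ∑ ξ, (β * ∫ ω, v ω 0 ^ 2 * p ξ ω ∂ν + (1 - n * δ ^ 2) / (4 * β)) +
        ∑ i : Fin n, (β * ∑ ξ, ∫ ω, v ω i.succ ^ 2 * p ξ ω ∂ν +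
        δ ^ 2 / (4 * β) * ∑ ξ, ∫ ω, (√(p ξ ω) - √(p (flipAt i ξ) ω)) ^ 2 ∂ν) :=
        add_le_add (Finset.sum_le_sum fun ξ _ => hzero ξ) (Finset.sum_le_sum fun i _ => hcoord i)
    _ = β * ∑ ξ, (∫ ω, v ω 0 ^ 2 * p ξ ω ∂ν + ∑ i : Fin n, ∫ ω, v ω i.succ ^ 2 * p ξ ω ∂ν) +
        2 ^ n * ((1 - n * δ ^ 2) / (4 * β)) + δ ^ 2 / (4 * β) *
          ∑ i, ∑ ξ, ∫ ω, (√(p ξ ω) - √(p (flipAt i ξ) ω)) ^ 2 ∂ν := by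
        simp only [Finset.sum_add_distrib, ← Finset.mul_sum]
        rw [Finset.sum_comm (f := fun ξ (i : Fin n) => ∫ ω, v ω i.succ ^ 2 * p ξ ω ∂ν)]
        simp
        ring
    _ ≤ β * ∑ _ξ : Fin n → Bool, 1 +
        2 ^ n * ((1 - n * δ ^ 2) / (4 * β)) + δ ^ 2 / (4 * β) *
          ∑ i, ∑ ξ, ∫ ω, (√(p ξ ω) - √(p (flipAt i ξ) ω)) ^ 2 ∂ν := by
        gcongr with ξ
        exact hnorm ξ
    _ = _ := by
        simp
        ring

/-! ### Densities in real-valued integrals, and exploration as information -/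

theorem integral_banditLaw {d : ℕ} (π : Policy d) {m : Ball d → ℝ} (hm : Measurable m) {t : ℕ}
    (g : History d t → ℝ) :
    ∫ h, g h ∂(banditLaw π m t) = ∫ h, likelihood m h * g h ∂(banditLaw π 0 t) := by
  rw [banditLaw_eq_withDensity π hm, integral_withDensity_eq_integral_toReal_smul (by fun_prop)
    (Filter.Eventually.of_forall fun _ => ENNReal.ofReal_lt_top)]
  refine integral_congr_ae (Filter.Eventually.of_forall fun h => ?_)
  simp [ENNReal.toReal_ofReal (likelihood_pos m h).le]

theorem lintegral_likelihood {d : ℕ} (π : Policy d) {m : Ball d → ℝ} (hm : Measurable m) (t : ℕ) :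
    ∫⁻ h, ENNReal.ofReal (likelihood m h) ∂(banditLaw π 0 t) = 1 := by
  have := isProbabilityMeasure_banditLaw π hm t
  have h := lintegral_banditLaw π hm (t := t) (G := fun _ => 1) measurable_const
  simpa using h.symm

theorem integrable_likelihood {d : ℕ} (π : Policy d) {m : Ball d → ℝ} (hm : Measurable m) (t : ℕ) :
    Integrable (likelihood m) (banditLaw π 0 t) := by
  refine ⟨(measurable_likelihood hm).aestronglyMeasurable, ?_⟩
  rw [hasFiniteIntegral_iff_ofReal (Filter.Eventually.of_forall fun h => (likelihood_pos m h).le),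
    lintegral_likelihood π hm]
  exact ENNReal.one_lt_top

theorem integral_likelihood {d : ℕ} (π : Policy d) {m : Ball d → ℝ} (hm : Measurable m) (t : ℕ) :
    ∫ h, likelihood m h ∂(banditLaw π 0 t) = 1 := by
  rw [integral_eq_lintegral_of_nonneg_ae
    (Filter.Eventually.of_forall fun h => (likelihood_pos m h).le)
    (measurable_likelihood hm).aestronglyMeasurable, lintegral_likelihood π hm, ENNReal.toReal_one]

/-- A flip changes only coordinate i of the parameter, by 2δ, so the inner product moves by 2δ |a_i|
and the Lipschitz bound applies. -/
theorem sq_meanReward_sub_le {f : ℝ → ℝ} {L : ℝ} (hL : LipschitzRegular f L) {n : ℕ} {δ : ℝ}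
    (hδ : n * δ ^ 2 ≤ 1) (ξ : Fin n → Bool) (i : Fin n) (a : Ball (n + 1)) :
    (meanReward f (capVertex hδ ξ) a - meanReward f (capVertex hδ (flipAt i ξ)) a) ^ 2 ≤
      4 * (L ^ 2 * δ ^ 2) * (a : EuclideanSpace ℝ (Fin (n + 1))) i.succ ^ 2 := by
  have h1 := hL _ (inner_mem_Icc (capVertex hδ ξ) a) _ (inner_mem_Icc (capVertex hδ (flipAt i ξ)) a)
  have h2 : inner ℝ (capVertex hδ ξ : EuclideanSpace ℝ (Fin (n + 1)))
      (a : EuclideanSpace ℝ (Fin (n + 1))) -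
      inner ℝ (capVertex hδ (flipAt i ξ) : EuclideanSpace ℝ (Fin (n + 1)))
      (a : EuclideanSpace ℝ (Fin (n + 1))) =
      2 * δ * sgn (ξ i) * (a : EuclideanSpace ℝ (Fin (n + 1))) i.succ := by
    rw [inner_capVertex, inner_capVertex, add_sub_add_left_eq_sub, ← Finset.sum_sub_distrib,
      Finset.sum_eq_single i]
    · rw [sgn_flipAt]; ring
    · intro j _ hj
      rw [flipAt_of_ne hj, sub_self]
    · simp
  rw [h2] at h1
  have h3 := pow_le_pow_left₀ (abs_nonneg _) h1 2
  rw [sq_abs, mul_pow, sq_abs] at h3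
  refine h3.trans (le_of_eq ?_)
  rw [mul_pow, mul_pow, mul_pow, sgn_sq]
  ring

/-- The exploration of a history: the squared lengths of the actions orthogonal to the pole. -/
noncomputable def exploration {n t : ℕ} (h : History (n + 1) t) : ℝ :=
  ∑ s, ∑ i : Fin n, ((h s).1 : EuclideanSpace ℝ (Fin (n + 1))) i.succ ^ 2

/-- A bound for the correlation of any estimator with a random vertex of a small cube around the
north pole, in terms of the exploration of the learner. -/
theorem sum_integral_inner_le {f : ℝ → ℝ} {L : ℝ} (hL : LipschitzRegular f L) {n : ℕ} {δ : ℝ}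
    (hδ : n * δ ^ 2 ≤ 1) (π : Policy (n + 1)) {t : ℕ}
    {v : History (n + 1) t → EuclideanSpace ℝ (Fin (n + 1))} (hv : Measurable v)
    (hv1 : ∀ h, ‖v h‖ ≤ 1) {β : ℝ} (hβ : 0 < β) :
    ∑ ξ, ∫ h, inner ℝ (capVertex hδ ξ : EuclideanSpace ℝ (Fin (n + 1))) (v h)
        ∂(historyLaw f π (capVertex hδ ξ) t) ≤
      2 ^ n * (β + (1 - n * δ ^ 2) / (4 * β)) + δ ^ 2 / (4 * β) *
        (L ^ 2 * δ ^ 2 * ∑ ξ, ∫ h, exploration h ∂(historyLaw f π (capVertex hδ ξ) t)) := by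
  have hm := fun ξ => measurable_meanReward hL.continuousOn (capVertex hδ ξ)
  set p : (Fin n → Bool) → History (n + 1) t → ℝ := fun ξ =>
    likelihood (meanReward f (capVertex hδ ξ)) with hp
  set ν := banditLaw π 0 t with hν
  have hpi : ∀ ξ, Integrable (p ξ) ν := fun ξ => integrable_likelihood π (hm ξ) t
  have hpm : ∀ ξ, Measurable (p ξ) := fun ξ => measurable_likelihood (hm ξ)
  have hp0 : ∀ ξ h, 0 ≤ p ξ h := fun ξ h => (likelihood_pos _ h).le
  set X : Fin n → History (n + 1) t → ℝ := fun i h =>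
    ∑ s, ((h s).1 : EuclideanSpace ℝ (Fin (n + 1))) i.succ ^ 2 with hX
  have hXm : ∀ i, Measurable (X i) := fun i => by fun_prop
  have hX0 : ∀ i h, 0 ≤ X i h := fun i h => Finset.sum_nonneg fun _ _ => sq_nonneg _
  have hXt : ∀ i h, ‖X i h‖ ≤ t := by
    intro i h
    rw [Real.norm_of_nonneg (hX0 i h)]
    calc X i h ≤ ∑ _s : Fin t, (1 : ℝ) := Finset.sum_le_sum fun s _ => by
          rw [← sq_abs]
          exact pow_le_one₀ (abs_nonneg _) (abs_coord_le_one (norm_ball_le _) _)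
      _ = t := by simp
  have hpX : ∀ ξ i, Integrable (fun h => p ξ h * X i h) ν := fun ξ i =>
    (hpi ξ).mul_bdd (hXm i).aestronglyMeasurable (Filter.Eventually.of_forall (hXt i))
  have hH : ∀ ξ i, ∫ h, (√(p ξ h) - √(p (flipAt i ξ) h)) ^ 2 ∂ν ≤
      1 / 2 * (L ^ 2 * δ ^ 2) * (∫ h, p ξ h * X i h ∂ν + ∫ h, p (flipAt i ξ) h * X i h ∂ν) := by
    intro ξ i
    have hpm1 := hpm ξ
    have hpm2 := hpm (flipAt i ξ)
    have hGi : Integrable (fun h => 1 / 2 * (L ^ 2 * δ ^ 2) *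
        (p ξ h * X i h + p (flipAt i ξ) h * X i h)) ν :=
      ((hpX _ _).add (hpX _ _)).const_mul _
    have hG0 : ∀ h, 0 ≤ 1 / 2 * (L ^ 2 * δ ^ 2) * (p ξ h * X i h + p (flipAt i ξ) h * X i h) := by
      intro h
      have := hp0 ξ h
      have := hp0 (flipAt i ξ) h
      have := hX0 i h
      positivity
    rw [← integral_add (hpX _ _) (hpX _ _), ← integral_const_mul,
      integral_eq_lintegral_of_nonneg_ae (Filter.Eventually.of_forall fun h => sq_nonneg _)
        (by fun_prop)]
    refine ENNReal.toReal_le_of_le_ofReal (integral_nonneg hG0) ?_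
    rw [ofReal_integral_eq_lintegral_ofReal hGi (Filter.Eventually.of_forall hG0)]
    refine (lintegral_hellinger_le π (hm ξ) (hm (flipAt i ξ)) t).trans
      (lintegral_mono fun h => ENNReal.ofReal_le_ofReal ?_)
    have h1 : ∑ s : Fin t, (meanReward f (capVertex hδ ξ) (h s).1 -
        meanReward f (capVertex hδ (flipAt i ξ)) (h s).1) ^ 2 ≤ 4 * (L ^ 2 * δ ^ 2) * X i h := by
      rw [hX, Finset.mul_sum]
      exact Finset.sum_le_sum fun s _ => sq_meanReward_sub_le hL hδ ξ i _
    have h2 : 0 ≤ 1 / 8 * (p ξ h + p (flipAt i ξ) h) := by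
      have := hp0 ξ h
      have := hp0 (flipAt i ξ) h
      positivity
    refine (mul_le_mul_of_nonneg_left h1 h2).trans (le_of_eq ?_)
    ring
  have hE : ∀ ξ, ∫ h, exploration h ∂(historyLaw f π (capVertex hδ ξ) t) =
      ∑ i, ∫ h, p ξ h * X i h ∂ν := by
    intro ξ
    rw [historyLaw_eq_banditLaw, integral_banditLaw π (hm ξ),
      ← integral_finsetSum _ fun i _ => hpX ξ i]
    refine integral_congr_ae (Filter.Eventually.of_forall fun h => ?_)
    simp only [exploration, hX, hp, ← Finset.mul_sum]
    rw [Finset.sum_comm]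
  have hsum : ∑ ξ, ∑ i, ∫ h, (√(p ξ h) - √(p (flipAt i ξ) h)) ^ 2 ∂ν ≤
      L ^ 2 * δ ^ 2 * ∑ ξ, ∫ h, exploration h ∂(historyLaw f π (capVertex hδ ξ) t) := by
    simp_rw [hE]
    calc _ ≤ ∑ ξ, ∑ i, 1 / 2 * (L ^ 2 * δ ^ 2) *
          (∫ h, p ξ h * X i h ∂ν + ∫ h, p (flipAt i ξ) h * X i h ∂ν) :=
          Finset.sum_le_sum fun ξ _ => Finset.sum_le_sum fun i _ => hH ξ i
      _ = _ := by
          rw [Finset.sum_comm, Finset.sum_comm (f := fun ξ i => ∫ h, p ξ h * X i h ∂ν),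
            Finset.mul_sum]
          refine Finset.sum_congr rfl fun i _ => ?_
          rw [← Finset.mul_sum, Finset.sum_add_distrib,
            sum_flipAt i fun ξ => ∫ h, p ξ h * X i h ∂ν]
          ring
  have key := sum_integral_mul_inner_le ν hδ hp0 hpm hpi
    (fun ξ => integral_likelihood π (hm ξ) t) hv hv1 hβ
  simp_rw [historyLaw_eq_banditLaw f π, integral_banditLaw π (hm _)] at hsum ⊢
  refine key.trans ?_
  gcongr

theorem exploration_le {n t : ℕ} (h : History (n + 1) t) : exploration h ≤ t := by
  calc exploration h ≤ ∑ _s : Fin t, (1 : ℝ) := Finset.sum_le_sum fun s _ => by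
        have := sum_sq_le_one (norm_ball_le (h s).1)
        rw [Fin.sum_univ_succ] at this
        nlinarith [sq_nonneg (((h s).1 : EuclideanSpace ℝ (Fin (n + 1))) 0)]
    _ = t := by simp

theorem exploration_nonneg {n t : ℕ} (h : History (n + 1) t) : 0 ≤ exploration h :=
  Finset.sum_nonneg fun _ _ => Finset.sum_nonneg fun _ _ => sq_nonneg _

theorem integrable_exploration {n t : ℕ} (μ : Measure (History (n + 1) t))
    [IsProbabilityMeasure μ] : Integrable exploration μ := by
  refine Integrable.of_bound ?_ t (Filter.Eventually.of_forall fun h => ?_)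
  · have : Measurable (exploration : History (n + 1) t → ℝ) := by unfold exploration; fun_prop
    exact this.aestronglyMeasurable
  · rw [Real.norm_of_nonneg (exploration_nonneg h)]
    exact exploration_le h

theorem mul_sq_sqrt_div {n : ℕ} (hn : 0 < n) {s : ℝ} (hs : 0 ≤ s) : n * √(s / n) ^ 2 = s := by
  rw [Real.sq_sqrt (by positivity)]
  field_simp

/-- The number of samples needed for accuracy `ε` in the learning phase. -/
theorem div_le_of_minimaxRisk_le {f : ℝ → ℝ} {L : ℝ} (hL0 : 0 < L) (hL : LipschitzRegular f L)
    {n : ℕ} (hn : 0 < n) {ε : ℝ} (hε : 0 < ε) (hε2 : ε < 1 / 2) {t : ℕ}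
    (ht : minimaxRisk f (n + 1) t ≤ ε) : n ^ 2 / (25 * L ^ 2 * ε) ≤ t := by
  by_contra! hlt
  rw [lt_div_iff₀ (by positivity)] at hlt
  -- With s = nδ², this choice satisfies 1 - s + ε/2 = (1 - ε)² = 4β² for the β below. If the
  -- information term is less than ε/2, the risk exceeds 1 - 2β = ε.
  set s := 5 / 2 * ε - ε ^ 2 with hs
  have hs0 : 0 ≤ s := by nlinarith
  have hs1 : s ≤ 1 := by nlinarith
  have hnδ := mul_sq_sqrt_div hn hs0
  have hδ2 : √(s / n) ^ 2 = s / n := Real.sq_sqrt (by positivity)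
  set δ := √(s / n) with hδdef
  have hδ : n * δ ^ 2 ≤ 1 := hnδ.le.trans hs1
  set β := (1 - ε) / 2 with hβ
  have hβ0 : 0 < β := by rw [hβ]; linarith
  have key : 1 - (β + (1 - n * δ ^ 2) / (4 * β)) - δ ^ 2 / (4 * β) * (L ^ 2 * δ ^ 2 * t) ≤
      minimaxRisk f (n + 1) t := by
    refine le_minimaxRisk hL.continuousOn n.succ_pos fun π e => ?_
    obtain ⟨v, hv, hv1, hrisk⟩ := exists_condMean e
    have hprob := fun ξ => isProbabilityMeasure_historyLaw hL.continuousOn π (capVertex hδ ξ) t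
    have h1 := sum_integral_inner_le hL hδ π hv hv1 hβ0
    have h2 : ∑ ξ, ∫ h, exploration h ∂(historyLaw f π (capVertex hδ ξ) t) ≤ 2 ^ n * t := by
      calc _ ≤ ∑ _ξ : Fin n → Bool, (t : ℝ) := Finset.sum_le_sum fun ξ _ => by
            have := hprob ξ
            calc _ ≤ ∫ _h, (t : ℝ) ∂(historyLaw f π (capVertex hδ ξ) t) :=
                  integral_mono (integrable_exploration _) (integrable_const _) exploration_le
              _ = t := by simp
        _ = _ := by simp
    obtain ⟨ξ, hξ⟩ := exists_of_sum_ge (a := fun ξ => risk f π e (capVertex hδ ξ))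
      (r := 1 - (β + (1 - n * δ ^ 2) / (4 * β)) - δ ^ 2 / (4 * β) * (L ^ 2 * δ ^ 2 * t)) (by
      have h3 : ∀ ξ, risk f π e (capVertex hδ ξ) =
          1 - ∫ h, inner ℝ (capVertex hδ ξ : EuclideanSpace ℝ (Fin (n + 1))) (v h)
            ∂(historyLaw f π (capVertex hδ ξ) t) := by
        intro ξ
        have := hprob ξ
        rw [hrisk, integral_sub (integrable_const _)]
        · simp
        · exact Integrable.of_bound (by fun_prop) 1
            (Filter.Eventually.of_forall fun h => abs_inner_le_one _ (hv1 h))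
      simp_rw [h3]
      rw [Finset.sum_sub_distrib]
      have h4 : δ ^ 2 / (4 * β) * (L ^ 2 * δ ^ 2 *
          ∑ ξ, ∫ h, exploration h ∂(historyLaw f π (capVertex hδ ξ) t)) ≤
          δ ^ 2 / (4 * β) * (L ^ 2 * δ ^ 2 * (2 ^ n * t)) := by gcongr
      simp only [Finset.sum_const, Finset.card_univ, Fintype.card_fun, Fintype.card_bool,
        Fintype.card_fin, nsmul_eq_mul, mul_one]
      push_cast
      linarith)
    exact ⟨_, hξ⟩
  have hlt2 : ε < 1 - (β + (1 - n * δ ^ 2) / (4 * β)) - δ ^ 2 / (4 * β) * (L ^ 2 * δ ^ 2 * t) := by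
    rw [hnδ]
    have h1 : δ ^ 2 * (L ^ 2 * δ ^ 2 * t) < ε / 2 := by
      rw [hδ2, show s / n * (L ^ 2 * (s / n) * t) = s ^ 2 * (L ^ 2 * t) / n ^ 2 by
        field_simp, div_lt_iff₀ (by positivity)]
      have h2 : s ^ 2 ≤ (5 / 2 * ε) ^ 2 := pow_le_pow_left₀ hs0 (by nlinarith [sq_nonneg ε]) 2
      calc s ^ 2 * (L ^ 2 * t) ≤ (5 / 2 * ε) ^ 2 * (L ^ 2 * t) := by gcongr
        _ = ε / 4 * (t * (25 * L ^ 2 * ε)) := by ring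
        _ ≤ ε / 4 * n ^ 2 := by gcongr
        _ < ε / 2 * n ^ 2 := by
          have : (0 : ℝ) < ε * n ^ 2 := by positivity
          linarith
    have h3 : 1 - (β + (1 - s) / (4 * β)) - δ ^ 2 / (4 * β) * (L ^ 2 * δ ^ 2 * t) =
        1 - β - (1 - s + δ ^ 2 * (L ^ 2 * δ ^ 2 * t)) / (4 * β) := by
      field_simp
      ring
    rw [h3]
    have h4 : (1 - s + δ ^ 2 * (L ^ 2 * δ ^ 2 * t)) / (4 * β) < β := by
      rw [div_lt_iff₀ (by positivity)]
      have : β * (4 * β) = 1 - 2 * ε + ε ^ 2 := by rw [hβ]; ring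
      rw [this, hs]
      linarith
    have : ε = 1 - 2 * β := by rw [hβ]; ring
    linarith
  linarith

/-! ### Reflection of the actions and the regret in the learning phase -/

/-- The action, reflected into the northern hemisphere. -/
noncomputable def northern {d : ℕ} (a : EuclideanSpace ℝ (Fin (d + 1))) :
    EuclideanSpace ℝ (Fin (d + 1)) := if 0 ≤ a 0 then a else -a

theorem measurable_northern {d : ℕ} :
    Measurable (northern : EuclideanSpace ℝ (Fin (d + 1)) → EuclideanSpace ℝ (Fin (d + 1))) :=
  Measurable.ite (measurableSet_le measurable_const (by fun_prop)) measurable_id measurable_neg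

theorem norm_northern {d : ℕ} (a : EuclideanSpace ℝ (Fin (d + 1))) : ‖northern a‖ = ‖a‖ := by
  unfold northern; split_ifs <;> simp

theorem northern_zero_nonneg {d : ℕ} (a : EuclideanSpace ℝ (Fin (d + 1))) :
    0 ≤ northern a 0 := by
  unfold northern
  split_ifs with h
  · exact h
  · simp; linarith

theorem northern_sq {d : ℕ} (a : EuclideanSpace ℝ (Fin (d + 1))) (i : Fin (d + 1)) :
    northern a i ^ 2 = a i ^ 2 := by
  unfold northern; split_ifs <;> simp

theorem abs_inner_northern {d : ℕ} (θ a : EuclideanSpace ℝ (Fin (d + 1))) :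
    |inner ℝ θ (northern a)| = |inner ℝ θ a| := by
  unfold northern; split_ifs <;> simp [inner_neg_right]

/-- After reflection the polar term is nonnegative, and by Cauchy–Schwarz the remaining one is at
least -1/2. For x ≥ -1/2 one has 1 - |x| ≥ (1 - x)/4, so the sign ambiguity of an even `f` costs a
constant only. -/
theorem one_sub_inner_northern_le {n : ℕ} {δ : ℝ} (hδ : n * δ ^ 2 ≤ 1) (hδ4 : n * δ ^ 2 ≤ 1 / 4)
    (ξ : Fin n → Bool) (a : Ball (n + 1)) :
    1 / 4 * (1 - inner ℝ (capVertex hδ ξ : EuclideanSpace ℝ (Fin (n + 1))) (northern a)) ≤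
      1 - |inner ℝ (capVertex hδ ξ : EuclideanSpace ℝ (Fin (n + 1)))
        (a : EuclideanSpace ℝ (Fin (n + 1)))| := by
  have hv : ‖northern (a : EuclideanSpace ℝ (Fin (n + 1)))‖ ≤ 1 :=
    (norm_northern _).le.trans (norm_ball_le a)
  rw [← abs_inner_northern]
  have h1 := abs_inner_le_one (capVertex hδ ξ) hv
  have h2 : -(1 / 2) ≤ inner ℝ (capVertex hδ ξ : EuclideanSpace ℝ (Fin (n + 1)))
      (northern (a : EuclideanSpace ℝ (Fin (n + 1)))) := by
    rw [inner_capVertex]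
    have h3 := sum_sq_le_one hv
    rw [Fin.sum_univ_succ] at h3
    set v := northern (a : EuclideanSpace ℝ (Fin (n + 1)))
    have h4 : (∑ i : Fin n, δ * sgn (ξ i) * v i.succ) ^ 2 ≤ 1 / 4 := by
      calc _ ≤ (∑ i : Fin n, (δ * sgn (ξ i)) ^ 2) * ∑ i : Fin n, v i.succ ^ 2 :=
            Finset.sum_mul_sq_le_sq_mul_sq _ _ _
        _ ≤ 1 / 4 * 1 := by
            gcongr
            · simpa [mul_pow, sgn_sq] using hδ4
            · nlinarith [sq_nonneg (v 0)]
        _ = 1 / 4 := by norm_num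
    have h5 := neg_le_of_abs_le (abs_le_of_sq_le_sq (h4.trans (by norm_num : (1 / 4 : ℝ) ≤
      (1 / 2) ^ 2)) (by norm_num))
    have h6 : 0 ≤ √(1 - n * δ ^ 2) * v 0 :=
      mul_nonneg (Real.sqrt_nonneg _) (northern_zero_nonneg _)
    linarith
  rcases abs_cases (inner ℝ (capVertex hδ ξ : EuclideanSpace ℝ (Fin (n + 1)))
      (northern (a : EuclideanSpace ℝ (Fin (n + 1))))) with ⟨h, -⟩ | ⟨h, -⟩ <;>
    rw [h] at h1 ⊢ <;> linarith

/-- Exploration is paid for by regret: ‖θ - v‖² ≤ 2(1 - ⟨θ, v⟩), and the part of θ orthogonal to the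
pole has squared length nδ². -/
theorem sum_sq_le_one_sub_inner {n : ℕ} {δ : ℝ} (hδ : n * δ ^ 2 ≤ 1) (ξ : Fin n → Bool)
    (a : Ball (n + 1)) :
    ∑ i : Fin n, (a : EuclideanSpace ℝ (Fin (n + 1))) i.succ ^ 2 ≤
      4 * (1 - inner ℝ (capVertex hδ ξ : EuclideanSpace ℝ (Fin (n + 1))) (northern a)) +
        2 * (n * δ ^ 2) := by
  simp_rw [← northern_sq (a : EuclideanSpace ℝ (Fin (n + 1)))]
  have hv : ‖northern (a : EuclideanSpace ℝ (Fin (n + 1)))‖ ≤ 1 :=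
    (norm_northern _).le.trans (norm_ball_le a)
  have hθ : ‖(capVertex hδ ξ : EuclideanSpace ℝ (Fin (n + 1)))‖ = 1 :=
    mem_sphere_zero_iff_norm.mp (capVertex hδ ξ).2
  set v := northern (a : EuclideanSpace ℝ (Fin (n + 1)))
  have h1 := norm_sub_sq_real (capVertex hδ ξ : EuclideanSpace ℝ (Fin (n + 1))) v
  rw [EuclideanSpace.real_norm_sq_eq (_ - v), Fin.sum_univ_succ, hθ] at h1
  have h2 : ‖v‖ ^ 2 ≤ 1 := pow_le_one₀ (norm_nonneg _) hv
  have h3 : ∑ i : Fin n, v i.succ ^ 2 ≤ ∑ i : Fin n,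
      (2 * ((capVertex hδ ξ : EuclideanSpace ℝ (Fin (n + 1))) - v) i.succ ^ 2 + 2 * δ ^ 2) := by
    refine Finset.sum_le_sum fun i _ => ?_
    rw [PiLp.sub_apply, capVertex_succ]
    have h4 : δ ^ 2 = (δ * sgn (ξ i)) ^ 2 := by rw [mul_pow, sgn_sq, mul_one]
    rw [h4]
    nlinarith [sq_nonneg (2 * (δ * sgn (ξ i)) - v i.succ)]
  rw [Finset.sum_add_distrib, ← Finset.mul_sum] at h3
  simp only [Finset.sum_const, Finset.card_univ, Fintype.card_fin, nsmul_eq_mul] at h3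
  nlinarith [sq_nonneg (((capVertex hδ ξ : EuclideanSpace ℝ (Fin (n + 1))) - v) 0)]

/-- The regret of the learning phase. -/
theorem mul_min_le_minimaxRegret {f : ℝ → ℝ} {cf Cf L : ℝ} (hcf : 0 < cf) (hL0 : 0 < L)
    (hf : BurnInRegular f) (hl : LearningRegular f cf Cf) (hL : LipschitzRegular f L)
    {n : ℕ} (hn : 0 < n) {T : ℕ} (hT : 1 ≤ T) :
    cf / 40 * (min (1 / 4) (n / (2 * L * √T)) * T) ≤ minimaxRegret f (n + 1) T := by
  have hT0 : (0 : ℝ) < T := by exact_mod_cast hT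
  have hc := hL.continuousOn
  -- s = nδ² is as large as possible with s² L² T ≤ n²/4, so that exploration of order sT does not
  -- reveal the signs; the cap 1/4 keeps the cube near the pole.
  set s := min (1 / 4) (n / (2 * L * √T)) with hs
  have hs0 : 0 ≤ s := le_min (by norm_num) (by positivity)
  have hs4 : s ≤ 1 / 4 := min_le_left _ _
  have hsT : s ^ 2 * (L ^ 2 * T) ≤ n ^ 2 / 4 := by
    have h1 : s * (2 * L * √T) ≤ n := by
      rw [← le_div_iff₀ (by positivity)]; exact min_le_right _ _
    have h2 := pow_le_pow_left₀ (by positivity) h1 2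
    have h3 : √(T : ℝ) ^ 2 = T := Real.sq_sqrt hT0.le
    have : (s * (2 * L * √T)) ^ 2 = 4 * (s ^ 2 * (L ^ 2 * T)) := by
      rw [mul_pow, mul_pow, mul_pow, h3]; ring
    linarith
  have hnδ := mul_sq_sqrt_div hn hs0
  have hδ2 : √(s / n) ^ 2 = s / n := Real.sq_sqrt (by positivity)
  set δ := √(s / n) with hδdef
  have hδ : n * δ ^ 2 ≤ 1 := hnδ.le.trans (by linarith)
  refine le_minimaxRegret hf hc fun π => ?_
  have hprob := fun ξ => isProbabilityMeasure_historyLaw hc π (capVertex hδ ξ) T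
  set θ : (Fin n → Bool) → EuclideanSpace ℝ (Fin (n + 1)) := fun ξ => capVertex hδ ξ with hθ
  set v : Fin T → History (n + 1) T → EuclideanSpace ℝ (Fin (n + 1)) := fun t h =>
    northern (h t).1 with hv
  have hvm : ∀ t, Measurable (v t) := fun t => measurable_northern.comp (by fun_prop)
  have hv1 : ∀ t h, ‖v t h‖ ≤ 1 := fun t h => (norm_northern _).le.trans (norm_ball_le _)
  set μ := fun ξ => historyLaw f π (capVertex hδ ξ) T with hμ
  have hin : ∀ ξ t, Integrable (fun h => inner ℝ (θ ξ) (v t h)) (μ ξ) := by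
    intro ξ t
    have := hvm t
    have := hprob ξ
    exact Integrable.of_bound (by fun_prop) 1
      (Filter.Eventually.of_forall fun h => abs_inner_le_one _ (hv1 t h))
  have hin1 : ∀ ξ, Integrable (fun h => ∑ t, (1 - inner ℝ (θ ξ) (v t h))) (μ ξ) := fun ξ =>
    have := hprob ξ
    integrable_finsetSum _ fun t _ => (integrable_const _).sub (hin ξ t)
  set D := ∑ ξ, ∫ h, ∑ t, (1 - inner ℝ (θ ξ) (v t h)) ∂(μ ξ) with hD
  set W := ∑ ξ, ∫ h, exploration h ∂(μ ξ) with hW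
  have hW1 : W ≤ 4 * D + 2 ^ n * (T * (2 * s)) := by
    have : ∀ ξ, ∫ h, exploration h ∂(μ ξ) ≤
        4 * ∫ h, ∑ t, (1 - inner ℝ (θ ξ) (v t h)) ∂(μ ξ) + T * (2 * s) := by
      intro ξ
      have := hprob ξ
      calc _ ≤ ∫ h, (4 * ∑ t, (1 - inner ℝ (θ ξ) (v t h)) + T * (2 * s)) ∂(μ ξ) := by
            refine integral_mono (integrable_exploration _)
              (((hin1 ξ).const_mul _).add (integrable_const _)) fun h => ?_
            have h1 : exploration h ≤
                ∑ t, (4 * (1 - inner ℝ (θ ξ) (v t h)) + 2 * (n * δ ^ 2)) :=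
              Finset.sum_le_sum fun t _ => sum_sq_le_one_sub_inner hδ ξ (h t).1
            rw [Finset.sum_add_distrib, ← Finset.mul_sum, hnδ] at h1
            simpa using h1
        _ = _ := by
            rw [integral_add ((hin1 ξ).const_mul _) (integrable_const _), integral_const_mul]
            simp
    refine (Finset.sum_le_sum fun ξ _ => this ξ).trans (le_of_eq ?_)
    rw [Finset.sum_add_distrib, ← Finset.mul_sum, ← hD]
    simp
  have hD1 : T * (2 ^ n * (s / 2) - s ^ 2 * L ^ 2 / (2 * n ^ 2) * W) ≤ D := by
    -- Each reflected action is regarded as an estimator based on the full history.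
    have h1 : ∀ t, ∑ ξ, ∫ h, inner ℝ (θ ξ) (v t h) ∂(μ ξ) ≤
        2 ^ n * (1 - s / 2) + s ^ 2 * L ^ 2 / (2 * n ^ 2) * W := by
      intro t
      refine (sum_integral_inner_le hL hδ π (hvm t) (hv1 t) (β := 1 / 2) (by norm_num)).trans
        (le_of_eq ?_)
      rw [hnδ, hδ2, ← hW]
      field_simp
      ring
    have h2 : D = T * 2 ^ n - ∑ t, ∑ ξ, ∫ h, inner ℝ (θ ξ) (v t h) ∂(μ ξ) := by
      have h3 : ∀ ξ, ∫ h, ∑ t, (1 - inner ℝ (θ ξ) (v t h)) ∂(μ ξ) =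
          T - ∑ t, ∫ h, inner ℝ (θ ξ) (v t h) ∂(μ ξ) := by
        intro ξ
        have := hprob ξ
        have hin2 : ∀ t ∈ (Finset.univ : Finset (Fin T)),
            Integrable (fun h => 1 - inner ℝ (θ ξ) (v t h)) (μ ξ) :=
          fun t _ => (integrable_const _).sub (hin ξ t)
        rw [integral_finsetSum _ hin2]
        simp_rw [integral_sub (integrable_const (1 : ℝ)) (hin ξ _)]
        simp
      rw [hD]
      simp_rw [h3]
      rw [Finset.sum_sub_distrib, Finset.sum_comm]
      simp [mul_comm]
    have h4 : ∑ t, ∑ ξ, ∫ h, inner ℝ (θ ξ) (v t h) ∂(μ ξ) ≤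
        ∑ _t : Fin T, (2 ^ n * (1 - s / 2) + s ^ 2 * L ^ 2 / (2 * n ^ 2) * W) :=
      Finset.sum_le_sum fun t _ => h1 t
    simp only [Finset.sum_const, Finset.card_univ, Fintype.card_fin, nsmul_eq_mul] at h4
    rw [h2]
    linarith
  -- If the regret were smaller, exploration would be at most 4/8 + 2 = 5/2 times 2ⁿ s T. The
  -- information term would then be at most 5/16 of 2ⁿ s T, forcing D ≥ (1/2 - 5/16) 2ⁿ s T, a
  -- contradiction.
  have hD2 : 2 ^ n * (s * T / 8) ≤ D := by
    by_contra! hlt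
    have hW2 : W ≤ 2 ^ n * (5 / 2 * (s * T)) := by linarith
    have h1 : T * (s ^ 2 * L ^ 2 / (2 * n ^ 2) * W) ≤ 5 / 16 * (2 ^ n * (s * T)) := by
      calc _ ≤ T * (s ^ 2 * L ^ 2 / (2 * n ^ 2) * (2 ^ n * (5 / 2 * (s * T)))) := by gcongr
        _ = s ^ 2 * (L ^ 2 * T) / (2 * n ^ 2) * (2 ^ n * (5 / 2 * (s * T))) := by ring
        _ ≤ (n ^ 2 / 4) / (2 * n ^ 2) * (2 ^ n * (5 / 2 * (s * T))) := by gcongr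
        _ = _ := by field_simp; ring
    have h2 : (0 : ℝ) ≤ 2 ^ n * (s * T) := by positivity
    linarith
  have hreg : ∀ ξ, 9 / 40 * cf * ∫ h, ∑ t, (1 - inner ℝ (θ ξ) (v t h)) ∂(μ ξ) ≤
      regret f π (capVertex hδ ξ) T := by
    intro ξ
    rw [hf.regret_eq, ← integral_const_mul]
    refine integral_mono ((hin1 ξ).const_mul _) (integrable_regret hf hc π _ T) fun h => ?_
    simp only [Finset.mul_sum]
    refine Finset.sum_le_sum fun t _ => ?_
    have h1 := one_sub_ge hcf hf hl (inner_mem_Icc (capVertex hδ ξ) (h t).1)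
    have h2 := one_sub_inner_northern_le hδ (hnδ.le.trans hs4) ξ (h t).1
    refine le_trans ?_ h1
    calc _ = 9 / 10 * cf * (1 / 4 * (1 - inner ℝ (θ ξ) (v t h))) := by ring
      _ ≤ _ := by gcongr
  obtain ⟨ξ, hξ⟩ := exists_of_sum_ge (a := fun ξ => regret f π (capVertex hδ ξ) T)
    (r := cf / 40 * (s * T)) (by
    refine le_trans ?_ (Finset.sum_le_sum fun ξ _ => hreg ξ)
    rw [← Finset.mul_sum, ← hD]
    have h1 := mul_le_mul_of_nonneg_left hD2 (by positivity : 0 ≤ 9 / 40 * cf)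
    have h2 : (0 : ℝ) ≤ 2 ^ n * (cf * (s * T)) := by positivity
    linarith)
  exact ⟨_, hξ⟩

/-! ### The two lower bounds -/

/-- The burn-in argument stops at 1/4. Beyond it the envelope is at least f(1/4) ≥ (3/20) c_f, so
the rest of the integral is bounded. -/
theorem burnInIntegral_le {f : ℝ → ℝ} {cf Cf : ℝ} (hcf : 0 < cf) (hf : BurnInRegular f)
    (hl : LearningRegular f cf Cf) (a : ℝ) :
    burnInIntegral f a ≤ (∫⁻ x in Set.Ioc a (1 / 4),
      ENNReal.ofReal (2 * x) / ENNReal.ofReal (envelope f x ^ 2)) +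
        ENNReal.ofReal (9 / cf ^ 2) := by
  have hsub : Set.Ioc a (1 / 2 : ℝ) ⊆ Set.Ioc a (1 / 4) ∪ Set.Ioc (1 / 4) (1 / 2) := by
    intro x hx
    rcases le_or_gt x (1 / 4) with h | h
    · exact Or.inl ⟨hx.1, h⟩
    · exact Or.inr ⟨h, hx.2⟩
  refine (lintegral_mono_set hsub).trans ((lintegral_union_le _ _ _).trans ?_)
  gcongr
  have hg : 3 / 20 * cf ≤ envelope f (1 / 4) := by
    have h1 := hl.mul_sub_le (x := 1 / 10) (y := 1 / 4) le_rfl (by norm_num) (by norm_num)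
    have h2 : 0 ≤ f (1 / 10) := by
      rw [← hf.map_zero]
      rcases hf.monotone with hm | ⟨-, hm⟩ <;>
        exact hm ⟨by norm_num, by norm_num⟩ ⟨by norm_num, by norm_num⟩ (by norm_num)
    have h3 : f (1 / 4) ≤ envelope f (1 / 4) := (le_abs_self _).trans (le_max_left _ _)
    linarith
  have hpos : 0 < (3 / 20 * cf) ^ 2 := by positivity
  calc ∫⁻ x in Set.Ioc (1 / 4 : ℝ) (1 / 2),
        ENNReal.ofReal (2 * x) / ENNReal.ofReal (envelope f x ^ 2)
      ≤ ∫⁻ x in Set.Ioc (1 / 4 : ℝ) (1 / 2),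
        ENNReal.ofReal (2 * x) * (ENNReal.ofReal ((3 / 20 * cf) ^ 2))⁻¹ := by
        refine setLIntegral_mono' measurableSet_Ioc fun x hx => ?_
        rw [div_eq_mul_inv]
        gcongr
        exact hg.trans (hf.envelope_mono (by norm_num) hx.1.le (by linarith [hx.2]))
    _ = ENNReal.ofReal ((1 / 2) ^ 2 - (1 / 4) ^ 2) * (ENNReal.ofReal ((3 / 20 * cf) ^ 2))⁻¹ := by
        rw [lintegral_mul_const _ (by fun_prop), lintegral_two_mul (by norm_num) (by norm_num)]
    _ ≤ _ := by
        rw [← div_eq_mul_inv, ← ENNReal.ofReal_div_of_pos hpos]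
        refine ENNReal.ofReal_le_ofReal ?_
        rw [div_le_div_iff₀ hpos (by positivity)]
        nlinarith [sq_nonneg cf]

theorem mul_natCast_mul_ofReal_two_div {d : ℕ} (hd : 0 < d) (N : ℕ) :
    (d : ℝ≥0∞) * (N * ENNReal.ofReal (2 / d)) = ENNReal.ofReal (2 * N) := by
  rw [← ENNReal.ofReal_natCast d, ← ENNReal.ofReal_natCast N,
    ← ENNReal.ofReal_mul (by positivity), ← ENNReal.ofReal_mul (by positivity)]
  congr 1
  field_simp

theorem sampleComplexity_lower {f : ℝ → ℝ} {cf Cf L : ℝ} (hcf : 0 < cf) (hL0 : 0 < L)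
    (hf : BurnInRegular f) (hl : LearningRegular f cf Cf) (hL : LipschitzRegular f L) {d : ℕ}
    (hd : 2 ≤ d) {ε : ℝ} (hε : 0 < ε) (hε2 : ε < 1 / 2) {t : ℕ} (ht : minimaxRisk f d t ≤ ε) :
    (⨆ (T : ℕ) (_ : 1 ≤ T), min ((d : ℝ≥0∞) *
        burnInIntegral f (Real.sqrt (20 * Real.log (T : ℝ) / (d : ℝ)))) (T : ℝ≥0∞)) +
      ENNReal.ofReal ((d : ℝ) ^ 2 / ε) ≤
      ENNReal.ofReal (3 + 100 * L ^ 2 * (2 + 9 / cf ^ 2)) * t := by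
  have hc := hL.continuousOn
  have hd0 : 0 < d := by omega
  have hd2 : (2 : ℝ) ≤ d := by exact_mod_cast hd
  obtain ⟨n, rfl⟩ : ∃ n, d = n + 1 := ⟨d - 1, by omega⟩
  set A := 100 * L ^ 2 with hA
  set K := 9 / cf ^ 2 with hK
  have hA0 : 0 < A := by positivity
  have hK0 : 0 < K := by positivity
  have hlearn : ((n + 1 : ℕ) : ℝ) ^ 2 / ε ≤ A * t := by
    -- Passing from n = d - 1 to d costs a factor 4, since d ≤ 2n; hence 100 = 4 · 25.
    have h1 := div_le_of_minimaxRisk_le hL0 hL (n := n) (by omega) hε hε2 ht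
    rw [div_le_iff₀ (by positivity)] at h1
    rw [div_le_iff₀ hε]
    push_cast at hd2 ⊢
    nlinarith
  have hdA : ((n + 1 : ℕ) : ℝ) ≤ A * t := by
    refine le_trans ?_ hlearn
    rw [le_div_iff₀ hε]
    nlinarith
  have hsum : ENNReal.ofReal (3 + A * (2 + K)) * t =
      ENNReal.ofReal ((3 + A + K * A) * t) + ENNReal.ofReal (A * t) := by
    rw [← ENNReal.ofReal_natCast t, ← ENNReal.ofReal_mul (by positivity),
      ← ENNReal.ofReal_add (by positivity) (by positivity)]
    congr 1
    ring
  rw [hsum]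
  refine add_le_add (iSup₂_le fun T hT => ?_) (ENNReal.ofReal_le_ofReal hlearn)
  have ht0 : (0 : ℝ) ≤ t := Nat.cast_nonneg t
  have hKAt : 0 ≤ K * A * t := by positivity
  have hAt : 0 ≤ A * t := by positivity
  -- For T ≤ t the cap T is already a valid bound. For T > t the integral must be at most 2t/d,
  -- since otherwise the risk would be at least 1/2 > ε. The case T = 1, where log T = 0, is covered
  -- by the cap.
  rcases Nat.lt_or_ge t T with htT | htT
  · rcases Nat.lt_or_ge T 2 with hT2 | hT2
    · refine (min_le_right _ _).trans ?_
      rw [← ENNReal.ofReal_natCast]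
      refine ENNReal.ofReal_le_ofReal ?_
      have : T = 1 := by omega
      rw [this, Nat.cast_one]
      nlinarith
    · refine (min_le_left _ _).trans ?_
      have hI : ∫⁻ x in Set.Ioc √(20 * Real.log T / (n + 1 : ℕ)) (1 / 4),
          ENNReal.ofReal (2 * x) / ENNReal.ofReal (envelope f x ^ 2) ≤
          t * ENNReal.ofReal (2 / (n + 1 : ℕ)) := by
        by_contra! hlt
        have hlog : 0 ≤ Real.log T := Real.log_natCast_nonneg T
        have hb := barrier_le hf hd0 (by positivity) hlt
        have := le_minimaxRisk hc hd0 fun π e => exists_half_le_risk hd0 hf hc hT2 htT hb π e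
        linarith
      calc _ ≤ ((n + 1 : ℕ) : ℝ≥0∞) * (t * ENNReal.ofReal (2 / (n + 1 : ℕ)) + ENNReal.ofReal K) := by
            gcongr
            exact (burnInIntegral_le hcf hf hl _).trans (by gcongr)
        _ = ENNReal.ofReal (2 * t + (n + 1 : ℕ) * K) := by
            rw [mul_add, mul_natCast_mul_ofReal_two_div hd0, ← ENNReal.ofReal_natCast (n + 1),
              ← ENNReal.ofReal_mul (by positivity),
              ← ENNReal.ofReal_add (by positivity) (by positivity)]
        _ ≤ _ := by
            refine ENNReal.ofReal_le_ofReal ?_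
            nlinarith [mul_le_mul_of_nonneg_right hdA hK0.le]
  · refine (min_le_right _ _).trans ?_
    rw [← ENNReal.ofReal_natCast]
    refine ENNReal.ofReal_le_ofReal ?_
    have : (T : ℝ) ≤ t := by exact_mod_cast htT
    nlinarith

theorem ennreal_min_add_le (a b c : ℝ≥0∞) : min (a + b) c ≤ min a c + min b c := by
  rcases le_total a c with h1 | h1 <;> rcases le_total b c with h2 | h2 <;> simp [h1, h2]

theorem min_burnIn_le {f : ℝ → ℝ} {cf Cf L : ℝ} (hcf : 0 < cf)
    (hf : BurnInRegular f) (hl : LearningRegular f cf Cf) (hL : LipschitzRegular f L) {d : ℕ}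
    (hd : 0 < d) {T : ℕ} (hT : 2 ≤ T) :
    min ((d : ℝ≥0∞) * ∫⁻ x in Set.Ioc √(20 * Real.log T / d) (1 / 4),
      ENNReal.ofReal (2 * x) / ENNReal.ofReal (envelope f x ^ 2)) T ≤
      ENNReal.ofReal (4 / cf * minimaxRegret f d T) := by
  have hc := hL.continuousOn
  set I := ∫⁻ x in Set.Ioc √(20 * Real.log T / d) (1 / 4),
      ENNReal.ofReal (2 * x) / ENNReal.ofReal (envelope f x ^ 2) with hI
  have hlog : 0 ≤ Real.log T := Real.log_natCast_nonneg T
  have key : ∀ N : ℕ, N + 1 ≤ T → N * ENNReal.ofReal (2 / d) < I →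
      2 * ((N + 1 : ℕ) : ℝ) ≤ 4 / cf * minimaxRegret f d T := by
    intro N hN hlt
    have := mul_le_minimaxRegret_of_barrier hcf hf hl hc hd hT hN
      (barrier_le hf hd (by positivity) hlt)
    rw [div_mul_eq_mul_div, le_div_iff₀ hcf]
    linarith
  by_cases h : I ≤ ((T - 1 : ℕ) : ℝ≥0∞) * ENNReal.ofReal (2 / d)
  · refine (min_le_left _ _).trans ?_
    -- For the least such N = M + 1, the barrier is still low at M, so M + 1 rounds of constant
    -- regret are forced, while d I ≤ 2(M + 1).
    have hex : ∃ N : ℕ, I ≤ N * ENNReal.ofReal (2 / d) := ⟨T - 1, h⟩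
    classical
    have hle : Nat.find hex ≤ T - 1 := Nat.find_min' hex h
    have hspec := Nat.find_spec hex
    rcases hN : Nat.find hex with _ | M
    · rw [hN] at hspec
      have : I = 0 := by simpa using hspec
      rw [this]; simp
    · have hlt := not_le.mp (Nat.find_min hex (m := M) (by omega))
      rw [hN] at hspec
      calc (d : ℝ≥0∞) * I ≤ d * ((M + 1 : ℕ) * ENNReal.ofReal (2 / d)) := by gcongr
        _ = ENNReal.ofReal (2 * (M + 1 : ℕ)) := mul_natCast_mul_ofReal_two_div hd _
        _ ≤ _ := ENNReal.ofReal_le_ofReal (key M (by omega) hlt)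
  · refine (min_le_right _ _).trans ?_
    have h1 := key (T - 1) (by omega) (not_le.mp h)
    rw [Nat.sub_add_cancel (by omega)] at h1
    rw [← ENNReal.ofReal_natCast]
    refine ENNReal.ofReal_le_ofReal ?_
    have : (0 : ℝ) ≤ T := Nat.cast_nonneg T
    linarith

theorem min_learning_le {f : ℝ → ℝ} {cf Cf L : ℝ} (hcf : 0 < cf) (hL0 : 0 < L)
    (hf : BurnInRegular f) (hl : LearningRegular f cf Cf) (hL : LipschitzRegular f L) {d : ℕ}
    (hd : 2 ≤ d) {T : ℕ} (hT : 1 ≤ T) :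
    min ((d : ℝ) * √T) T ≤ 160 * (1 + L) / cf * minimaxRegret f d T := by
  obtain ⟨n, rfl⟩ : ∃ n, d = n + 1 := ⟨d - 1, by omega⟩
  have hn : (1 : ℝ) ≤ n := by exact_mod_cast (show 1 ≤ n by omega)
  have hT0 : (0 : ℝ) < T := by exact_mod_cast hT
  have h := mul_min_le_minimaxRegret hcf hL0 hf hl hL (n := n) (by omega) hT
  set m := min (((n + 1 : ℕ) : ℝ) * √T) T with hm
  have hm0 : 0 ≤ m := le_min (by positivity) hT0.le
  have h1 : m / (4 * (1 + L)) ≤ min (1 / 4) (n / (2 * L * √T)) * T := by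
    rw [min_mul_of_nonneg _ _ hT0.le]
    refine le_min ?_ ?_
    · rw [div_le_iff₀ (by positivity)]
      have : m ≤ T := min_le_right _ _
      nlinarith
    · have h2 : (n : ℝ) / (2 * L * √T) * T = n * √T / (2 * L) := by
        have h3 : √(T : ℝ) * √T = T := Real.mul_self_sqrt hT0.le
        have h4 : 0 < √(T : ℝ) := Real.sqrt_pos.mpr hT0
        field_simp
        linear_combination -h3
      rw [h2, div_le_div_iff₀ (by positivity) (by positivity)]
      have h5 : m ≤ 2 * n * √T := (min_le_left _ _).trans (by
        push_cast
        gcongr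
        linarith)
      have h6 : 0 ≤ (n : ℝ) * √T := by positivity
      nlinarith
  have h7 : cf / 40 * (m / (4 * (1 + L))) ≤ minimaxRegret f (n + 1) T :=
    (mul_le_mul_of_nonneg_left h1 (by positivity)).trans h
  have h8 := mul_le_mul_of_nonneg_left h7 (by positivity : 0 ≤ 160 * (1 + L) / cf)
  refine le_trans (le_of_eq ?_) h8
  field_simp
  ring

theorem minimaxRegret_lower {f : ℝ → ℝ} {cf Cf L : ℝ} (hcf : 0 < cf) (hL0 : 0 < L)
    (hf : BurnInRegular f) (hl : LearningRegular f cf Cf) (hL : LipschitzRegular f L) {d : ℕ}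
    (hd : 2 ≤ d) {T : ℕ} (hT : 1 ≤ T) :
    min ((d : ℝ≥0∞) * burnInIntegral f (Real.sqrt (20 * Real.log (T : ℝ) / (d : ℝ))) +
        ENNReal.ofReal ((d : ℝ) * Real.sqrt (T : ℝ))) (T : ℝ≥0∞) ≤
      ENNReal.ofReal ((4 / cf + (1 + 9 / cf ^ 2) * (160 * (1 + L) / cf)) * minimaxRegret f d T) := by
  have hlearn := min_learning_le hcf hL0 hf hl hL hd hT
  have hT1 : (1 : ℝ) ≤ T := by exact_mod_cast hT
  have hd2 : (2 : ℝ) ≤ d := by exact_mod_cast hd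
  have hsq : 1 ≤ √(T : ℝ) := Real.one_le_sqrt.mpr hT1
  set r := minimaxRegret f d T with hr
  set A := 160 * (1 + L) / cf with hA
  set K := 9 / cf ^ 2 with hK
  have hA0 : 0 < A := by positivity
  have hK0 : 0 < K := by positivity
  have hm1 : 1 ≤ min ((d : ℝ) * √T) T := le_min (by nlinarith) hT1
  have hAr : 1 ≤ A * r := hm1.trans hlearn
  have hr0 : 0 < r := by
    by_contra! h
    nlinarith
  rcases Nat.lt_or_ge T 2 with hT2 | hT2
  · refine (min_le_right _ _).trans ?_
    have : T = 1 := by omega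
    rw [← ENNReal.ofReal_natCast, this, Nat.cast_one]
    refine ENNReal.ofReal_le_ofReal ?_
    have h1 : 0 ≤ 4 / cf * r := by positivity
    have h2 : 0 ≤ K * (A * r) := by positivity
    nlinarith
  · set I := ∫⁻ x in Set.Ioc √(20 * Real.log T / d) (1 / 4),
      ENNReal.ofReal (2 * x) / ENNReal.ofReal (envelope f x ^ 2) with hI
    have hburn := min_burnIn_le hcf hf hl hL (d := d) (by omega) hT2
    have hrest : min (ENNReal.ofReal (d * K + d * √T)) (T : ℝ≥0∞) ≤
        ENNReal.ofReal ((1 + K) * (A * r)) := by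
      rw [← ENNReal.ofReal_natCast, ← ENNReal.ofReal_min]
      refine ENNReal.ofReal_le_ofReal ?_
      calc min (d * K + d * √T) (T : ℝ) ≤ (1 + K) * min ((d : ℝ) * √T) T := by
            rw [mul_min_of_nonneg _ _ (by positivity)]
            refine min_le_min ?_ (by nlinarith)
            -- Since √T ≥ 1, the leftover dK of the integral is absorbed into d√T.
            have : d * K * 1 ≤ d * K * √T := by gcongr
            linarith
        _ ≤ _ := by gcongr
    calc _ ≤ min (d * (I + ENNReal.ofReal K) + ENNReal.ofReal ((d : ℝ) * √T)) (T : ℝ≥0∞) := by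
          gcongr
          exact burnInIntegral_le hcf hf hl _
      _ = min (d * I + ENNReal.ofReal (d * K + d * √T)) (T : ℝ≥0∞) := by
          rw [mul_add, add_assoc, ENNReal.ofReal_add (by positivity) (by positivity),
            ENNReal.ofReal_mul (p := d) (q := K) (by positivity), ENNReal.ofReal_natCast]
      _ ≤ min (d * I) (T : ℝ≥0∞) + min (ENNReal.ofReal (d * K + d * √T)) (T : ℝ≥0∞) :=
          ennreal_min_add_le _ _ _
      _ ≤ ENNReal.ofReal (4 / cf * r) + ENNReal.ofReal ((1 + K) * (A * r)) :=
          add_le_add hburn hrest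
      _ = _ := by
          rw [← ENNReal.ofReal_add (by positivity) (by positivity)]
          congr 1
          ring

theorem ofReal_mul_le_of_le {a b : ℝ≥0∞} {C M : ℝ} (hM : 0 < M) (hC : C ≤ M⁻¹)
    (h : a ≤ ENNReal.ofReal M * b) : ENNReal.ofReal C * a ≤ b := by
  calc ENNReal.ofReal C * a ≤ ENNReal.ofReal M⁻¹ * (ENNReal.ofReal M * b) := by gcongr
    _ = b := by
      rw [← mul_assoc, ← ENNReal.ofReal_mul (by positivity), inv_mul_cancel₀ hM.ne',
        ENNReal.ofReal_one, one_mul]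

end RidgeBandit

theorem corollary1p8 :
    ∃ c : ℝ, 0 < c ∧ ∀ cf L : ℝ, 0 < cf → 0 < L → ∃ C : ℝ, 0 < C ∧
      ∀ (d : ℕ) (f : ℝ → ℝ) (Cf : ℝ), 2 ≤ d →
        RidgeBandit.BurnInRegular f →
        RidgeBandit.LearningRegular f cf Cf →
        RidgeBandit.LipschitzRegular f L →
        (∀ ε : ℝ, 0 < ε → ε < 1 / 2 →
          ENNReal.ofReal C *
            ((⨆ (T : ℕ) (_ : 1 ≤ T),
                min ((d : ℝ≥0∞) *
                  RidgeBandit.burnInIntegral f (Real.sqrt (c * Real.log (T : ℝ) / (d : ℝ))))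
                  (T : ℝ≥0∞))
              + ENNReal.ofReal ((d : ℝ) ^ 2 / ε))
            ≤ ((RidgeBandit.sampleComplexity f d ε : ℕ∞) : ℝ≥0∞)) ∧
        (∀ T : ℕ, 1 ≤ T →
          ENNReal.ofReal C *
            min ((d : ℝ≥0∞) *
                RidgeBandit.burnInIntegral f (Real.sqrt (c * Real.log (T : ℝ) / (d : ℝ)))
                + ENNReal.ofReal ((d : ℝ) * Real.sqrt (T : ℝ)))
              (T : ℝ≥0∞)
            ≤ ENNReal.ofReal (RidgeBandit.minimaxRegret f d T)) := by
  refine ⟨20, by norm_num, fun cf L hcf hL0 => ?_⟩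
  set M₁ := 3 + 100 * L ^ 2 * (2 + 9 / cf ^ 2) with hM₁
  set M₂ := 4 / cf + (1 + 9 / cf ^ 2) * (160 * (1 + L) / cf) with hM₂
  have h₁ : 0 < M₁ := by positivity
  have h₂ : 0 < M₂ := by positivity
  refine ⟨min M₁⁻¹ M₂⁻¹, by positivity, fun d f Cf hd hf hl hL => ⟨fun ε hε hε2 => ?_,
    fun T hT => ?_⟩⟩
  · rw [RidgeBandit.sampleComplexity]
    simp only [ENat.toENNReal_iInf]
    refine le_iInf₂ fun t ht => ?_
    rw [ENat.toENNReal_coe]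
    exact RidgeBandit.ofReal_mul_le_of_le h₁ (min_le_left _ _)
      (RidgeBandit.sampleComplexity_lower hcf hL0 hf hl hL hd hε hε2 ht)
  · refine RidgeBandit.ofReal_mul_le_of_le h₂ (min_le_right _ _) ?_
    rw [← ENNReal.ofReal_mul h₂.le]
    exact RidgeBandit.minimaxRegret_lower hcf hL0 hf hl hL hd hT
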